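/- Let $q\in(0,1)$ and $p=1-q$. For a finite interval $\Lambda=\{a,a+1,\dots,b\}\subset\mathbb Z$ with $a\le b$, let $\Omega_\Lambda=\{0,1\}^\Lambda$, let $\pi_\Lambda$ be the product over $\Lambda$ of Bernoulli$(1-q)$ measures (each site takes the value $1$ with probability $p$ and $0$ with probability $q$), and write $\pi_\Lambda(f)$ and $\operatorname{Var}_\Lambda(f)$ for the mean and variance of $f:\Omega_\Lambda\to\mathbb R$ under $\pi_\Lambda$. The Dirichlet form of the East model on $\Lambda$ with zero boundary condition is $$\mathcal D_\Lambda(f,g)=\frac12\sum_{x\in\Lambda}\sum_{\sigma\in\Omega_\Lambda}\pi_\Lambda(\sigma)\,c_x^\Lambda(\sigma)\,[(1-\sigma(x))p+\sigma(x)q]\,(f(\sigma^x)-f(\sigma))(g(\sigma^x)-g(\sigma)),$$ where $\sigma^x$ is $\sigma$ with its value at $x$ flipped, $c_x^\Lambda(\sigma)=1-\sigma(x+1)$ for $x\in\Lambda\setminus\{b\}$, and $c_b^\Lambda(\sigma)=1$. For $f:\Omega_\Lambda\to(0,\infty)$ let $\operatorname{Ent}_\Lambda(f)=\pi_\Lambda\big(f\log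 (f/\pi_\Lambda(f))\big)$. For $\alpha\in(0,2]$ and $C\in(0,\infty)$, the $\alpha$-log-Sobolev inequality on $\Lambda$ with constant $C$ states that, for all $f:\Omega_\Lambda\to(0,\infty)$, $$\operatorname{Ent}_\Lambda(f)\le\frac{\alpha\alpha' C}{4}\,\mathcal D_\Lambda\big(f^{1/\alpha},f^{1/\alpha'}\big),\qquad \frac1\alpha+\frac1{\alpha'}=1,\qquad\text{if }\alpha\ne1,$$ and $$\operatorname{Ent}_\Lambda(f)\le\frac{C}{4}\,\mathcal D_\Lambda(f,\log f)\qquad\text{if }\alpha=1.$$ Then: (i) For every $\alpha\in(0,2]$ there is a constant $c\in(0,\infty)$, depending only on $q$ and $\alpha$, such that for every nonempty finite interval $\Lambda\subset\mathbb Z$ there is a smallest constant $C_\alpha(\Lambda)\in(0,\infty)$ in the $\alpha$-log-Sobolev inequality on $\Lambda$, and $$\frac1c|\Lambda|\le C_\alpha(\Lambda)\le c|\Lambda|.$$ In particular, for no $\alpha\in(0,2]$ does the $\alpha$-log-Sobolev inequality hold on all nonempty finite intervals $\Lambda$ with one and the same constant. (ii) In contrast, the Poincaré inequality holds uniformly in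 the volume: there is a constant $C\in(0,\infty)$, depending only on $q$, such that $\operatorname{Var}_\Lambda(f)\le C\,\mathcal D_\Lambda(f,f)$ for every nonempty finite interval $\Lambda$ and every $f:\Omega_\Lambda\to\mathbb R$. -/

import Mathlib

noncomputable section

namespace EastModel

/-- Configurations on the interval `Λ = [a,b] ∩ ℤ`; `true` means occupied (value `1`) and
`false` means empty (value `0`). -/
abbrev Config (a b : ℤ) : Type := Finset.Icc a b → Bool

/-- The weight `π_Λ(σ)` of the product of Bernoulli(`1 - q`) measures: a site is occupied with
probability `1 - q` and empty with probability `q`. -/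
def weight (q : ℝ) {a b : ℤ} (σ : Config a b) : ℝ :=
  ∏ x, if σ x then 1 - q else q

/-- The mean `π_Λ(f)`. -/
def mean (q : ℝ) {a b : ℤ} (f : Config a b → ℝ) : ℝ :=
  ∑ σ, weight q σ * f σ

/-- The variance `Var_Λ(f) = π_Λ((f - π_Λ(f))²)`. -/
def variance (q : ℝ) {a b : ℤ} (f : Config a b → ℝ) : ℝ :=
  mean q fun σ => (f σ - mean q f) ^ 2

/-- The entropy `Ent_Λ(f) = π_Λ(f log (f / π_Λ(f)))`, used for positive `f`. -/
def entropy (q : ℝ) {a b : ℤ} (f : Config a b → ℝ) : ℝ :=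
  mean q fun σ => f σ * Real.log (f σ / mean q f)

/-- The configuration `σ^x` obtained from `σ` by flipping its value at `x`. -/
def flip {a b : ℤ} (σ : Config a b) (x : Finset.Icc a b) : Config a b :=
  Function.update σ x (!σ x)

/-- The constraint `c_x^Λ(σ)` with a frozen zero at `b + 1`: it is `1 - σ(x+1)` for `x ∈ [a,b)`
and `1` for `x = b`. -/
def constraint {a b : ℤ} (σ : Config a b) (x : Finset.Icc a b) : ℝ :=
  if h : x.1 < b then
    (if σ ⟨x.1 + 1, by
        have h1 := Finset.mem_Icc.mp x.2
        exact Finset.mem_Icc.mpr ⟨by omega, by omega⟩⟩ then 0 else 1)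
  else 1

/-- The factor `(1 - σ(x)) p + σ(x) q`, with `p = 1 - q`. -/
def flipRate (q : ℝ) {a b : ℤ} (σ : Config a b) (x : Finset.Icc a b) : ℝ :=
  if σ x then q else 1 - q

/-- The Dirichlet form `𝓓_Λ(f,g)` of the East model on `Λ = [a,b]` with zero boundary
condition. -/
def dirichlet (q : ℝ) {a b : ℤ} (f g : Config a b → ℝ) : ℝ :=
  (1 / 2) * ∑ x, ∑ σ, weight q σ * constraint σ x * flipRate q σ x *
    (f (flip σ x) - f σ) * (g (flip σ x) - g σ)

/-- The functional on the right-hand side of the `α`-log-Sobolev inequality: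
`(α α' / 4) 𝓓_Λ(f^{1/α}, f^{1/α'})` with `1/α + 1/α' = 1` for `α ≠ 1`, and its limit
`(1/4) 𝓓_Λ(f, log f)` for `α = 1`. -/
def alphaEnergy (q α : ℝ) {a b : ℤ} (f : Config a b → ℝ) : ℝ :=
  if α = 1 then
    (1 / 4) * dirichlet q f (fun σ => Real.log (f σ))
  else
    α * (α / (α - 1)) / 4 *
      dirichlet q (fun σ => f σ ^ (1 / α)) (fun σ => f σ ^ (1 / (α / (α - 1))))

/-- The set of constants `C ∈ (0,∞)` with which `π_Λ`, `Λ = [a,b]`, satisfies the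
`α`-log-Sobolev inequality (for all positive functions). -/
def alphaLogSobolevConstants (q α : ℝ) (a b : ℤ) : Set ℝ :=
  {C | 0 < C ∧ ∀ f : Config a b → ℝ, (∀ σ, 0 < f σ) → entropy q f ≤ C * alphaEnergy q α f}

/-- The best possible constant `C_α(Λ)`, `Λ = [a,b]`. -/
def bestConstant (q α : ℝ) (a b : ℤ) : ℝ :=
  sInf (alphaLogSobolevConstants q α a b)

end EastModel

end

/-!
The theorem rests on three estimates for the East model on `Λ = [a,b]`, with `n = |Λ|` and
`m = min q (1 - q)`. The sites are numbered from the right end, so that `k` stands for `b - k`.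

*Poincaré inequality* (`exists_variance_le`). Let `P_k` be the average over the `k` rightmost sites
(`tailMean`) and `E_k` the average over the site `b - k` (`siteMean`). These are orthogonal
projections of `L²(π_Λ)`, and the variance is the sum of the terms
`V_k = π(((P_k - P_{k+1}) f)²)`. Fix a length `L` and let `B` be the event that the `L` sites to the
right of `b - k` all lie in `Λ` and are occupied; its probability is at most `(1 - q) ^ L`. Splitting
`(P_k - P_{k+1}) f = P_k (f - E_k f)` according to `B`, the Cauchy–Schwarz inequality bounds the
part on `B` by `(1 - q) ^ L` times the sum of the `V_i` with `k - L ≤ i ≤ k`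
(`mean_sq_tailMean_sub_le`). As `L (1 - q) ^ L → 0`, for large `L` these parts are absorbed into the
variance, uniformly in `n`, which leaves a Poincaré inequality for the long-range constraint "some
site within distance `L` to the right is empty" (`variance_le_of_blocked`). A flip allowed by the
long-range constraint is a composition of boundedly many flips allowed by the East constraint
(`rangeEnergy_succ_succ_le`), at a cost depending only on `L` and `m`.

*Upper bound for the log-Sobolev constants* (`exists_entropy_le`). For positive `g` the ratio of `g`
to its mean is at most `(1 / m) ^ n`, so an elementary inequality for `u² log u²` gives
`Ent(g²) ≤ (5 + 8 n log (1 / m)) Var(g)` (`entropy_sq_le`). With `g = √f`, the Poincaré inequality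
and the Stroock–Varopoulos inequality `𝓓(√f, √f) ≤ alphaEnergy q α f`
(`dirichlet_sqrt_le_alphaEnergy`) this bounds the constant by a multiple of `n`.

*Lower bound* (`exists_mul_card_le`). Let `h` be the number of consecutive occupied sites at the left
end and test with `f = r ^ h`. Because a site is flipped only when its right neighbour is empty, `h`
changes by at most one in a transition, and at most two sites can change it. The energy of `f` is
therefore at most a constant times `π(f)`, for every `α` (`alphaEnergy_testFunction_le`). For large
`r` the measure with density `f / π(f)` is concentrated on the fully occupied configuration, so the
entropy is of order `n π(f)` (`entropy_testFunction_ge`).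
-/

noncomputable section

namespace EastModel

variable {a b : ℤ}

/-! ### Means under the product measure -/

lemma weight_nonneg {q : ℝ} (hq0 : 0 ≤ q) (hq1 : q ≤ 1) (σ : Config a b) : 0 ≤ weight q σ :=
  Finset.prod_nonneg fun x _ => by split_ifs <;> linarith

lemma mean_add (q : ℝ) (f g : Config a b → ℝ) :
    mean q (fun σ => f σ + g σ) = mean q f + mean q g := by
  simp only [mean, mul_add, Finset.sum_add_distrib]

lemma mean_sub (q : ℝ) (f g : Config a b → ℝ) :
    mean q (fun σ => f σ - g σ) = mean q f - mean q g := by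
  simp only [mean, mul_sub, Finset.sum_sub_distrib]

lemma mean_const_mul (q r : ℝ) (f : Config a b → ℝ) :
    mean q (fun σ => r * f σ) = r * mean q f := by
  simp only [mean, Finset.mul_sum]
  exact Finset.sum_congr rfl fun σ _ => by ring

lemma mean_mono {q : ℝ} (hq0 : 0 ≤ q) (hq1 : q ≤ 1) {f g : Config a b → ℝ}
    (h : ∀ σ, f σ ≤ g σ) : mean q f ≤ mean q g :=
  Finset.sum_le_sum fun σ _ => mul_le_mul_of_nonneg_left (h σ) (weight_nonneg hq0 hq1 σ)

lemma mean_nonneg {q : ℝ} (hq0 : 0 ≤ q) (hq1 : q ≤ 1) {f : Config a b → ℝ}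
    (h : ∀ σ, 0 ≤ f σ) : 0 ≤ mean q f :=
  Finset.sum_nonneg fun σ _ => mul_nonneg (weight_nonneg hq0 hq1 σ) (h σ)

/-- The mean of a product of functions of the single sites factorizes. -/
lemma mean_prod (q : ℝ) (g : Finset.Icc a b → Bool → ℝ) :
    mean q (fun σ : Config a b => ∏ x, g x (σ x)) =
      ∏ x, (q * g x false + (1 - q) * g x true) := by
  have h : ∀ x, q * g x false + (1 - q) * g x true =
      ∑ v : Bool, (if v then 1 - q else q) * g x v := by
    intro x
    simp [add_comm]
  simp only [h, Finset.prod_univ_sum, mean, weight, Fintype.piFinset_univ, Finset.prod_mul_distrib]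

lemma mean_const (q r : ℝ) : mean q (fun _ : Config a b => r) = r := by
  have h := mean_prod (a := a) (b := b) q fun _ _ => 1
  have h2 := mean_const_mul q r fun _ : Config a b => 1
  simp only [Finset.prod_const_one, mul_one] at h h2
  rw [h2, h]
  simp

lemma flip_flip (σ : Config a b) (x : Finset.Icc a b) : flip (flip σ x) x = σ := by
  ext y
  by_cases h : y = x
  · subst h; simp [flip]
  · simp [flip, h]

/-- Detailed balance for the resampling of the site `x`. -/
lemma weight_mul_flipRate_flip (q : ℝ) (σ : Config a b) (x : Finset.Icc a b) :
    weight q (flip σ x) * flipRate q (flip σ x) x = weight q σ * flipRate q σ x := by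
  have h : ∀ τ : Config a b, weight q τ * flipRate q τ x =
      (q * (1 - q)) * ∏ y ∈ Finset.univ.erase x, (if τ y then 1 - q else q) := by
    intro τ
    rw [weight, ← Finset.mul_prod_erase _ _ (Finset.mem_univ x), flipRate]
    split_ifs <;> ring
  rw [h, h]
  congr 1
  refine Finset.prod_congr rfl fun y hy => ?_
  simp [flip, (Finset.mem_erase.mp hy).1]

lemma sum_weight_mul_flipRate_flip (q : ℝ) (x : Finset.Icc a b) (f : Config a b → ℝ) :
    ∑ σ, weight q σ * flipRate q σ x * f (flip σ x) = ∑ σ, weight q σ * flipRate q σ x * f σ := by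
  have h : Function.Involutive fun σ : Config a b => flip σ x := fun σ => flip_flip σ x
  rw [← Equiv.sum_comp h.toPerm]
  refine Finset.sum_congr rfl fun σ _ => ?_
  simp only [Function.Involutive.coe_toPerm]
  rw [weight_mul_flipRate_flip, flip_flip]

/-! ### Averages over single sites and over the sites near the right end -/

/-- The configuration `σ` with its value at the site `b - k` replaced by `v`. The sites are
numbered from the right end of the interval; when `b - k` is outside it, nothing changes. -/
def put (k : ℕ) (v : Bool) (σ : Config a b) : Config a b :=
  fun x => if x.1 = b - k then v else σ x

/-- The site `b - k` belongs to the interval and is occupied. -/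
def Occupied (k : ℕ) (σ : Config a b) : Prop := ∃ x : Finset.Icc a b, x.1 = b - k ∧ σ x = true

lemma put_put (k : ℕ) (v w : Bool) (σ : Config a b) : put k v (put k w σ) = put k v σ := by
  ext x; by_cases h : x.1 = b - k <;> simp [put, h]

lemma put_comm {j k : ℕ} (h : j ≠ k) (v w : Bool) (σ : Config a b) :
    put j v (put k w σ) = put k w (put j v σ) := by
  ext x
  by_cases h1 : x.1 = b - j <;> by_cases h2 : x.1 = b - k <;> simp only [put, h1, h2, if_true]
  · omega
  all_goals simp_all

lemma occupied_put_of_ne {j k : ℕ} (h : j ≠ k) (v : Bool) (σ : Config a b) :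
    Occupied j (put k v σ) ↔ Occupied j σ := by
  refine exists_congr fun x => and_congr_right fun hx => ?_
  have : x.1 ≠ b - k := by omega
  simp [put, this]

lemma not_occupied_put_false (k : ℕ) (σ : Config a b) : ¬ Occupied k (put k false σ) := by
  rintro ⟨x, hx, h⟩
  simp [put, hx] at h

lemma put_eq_update {k : ℕ} {x : Finset.Icc a b} (hx : x.1 = b - k) (v : Bool) (σ : Config a b) :
    put k v σ = Function.update σ x v := by
  ext y
  by_cases h : y = x
  · subst h; simp [put, hx]
  · have : y.1 ≠ b - k := fun h' => h (Subtype.ext (h'.trans hx.symm))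
    simp [put, this, h]

/-- Every configuration is one of the two obtained from it by prescribing the value at a site. -/
lemma put_self (k : ℕ) (σ : Config a b) : put k true σ = σ ∨ put k false σ = σ := by
  by_cases h : Occupied k σ
  · left
    obtain ⟨x, hx, h⟩ := h
    rw [put_eq_update hx, ← h, Function.update_eq_self]
  · right
    ext y
    by_cases hy : y.1 = b - k
    · have : σ y = false := by
        by_contra h2
        exact h ⟨y, hy, by simpa using h2⟩
      simp [put, hy, this]
    · simp [put, hy]

/-- The function `f` does not depend on the value at the site `b - k`. -/
def IndepOf (k : ℕ) (f : Config a b → ℝ) : Prop := ∀ v σ, f (put k v σ) = f σ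

/-- The average over the value at the site `b - k`. -/
def siteMean (q : ℝ) (k : ℕ) : (Config a b → ℝ) →ₗ[ℝ] (Config a b → ℝ) where
  toFun f σ := q * f (put k false σ) + (1 - q) * f (put k true σ)
  map_add' f g := by ext σ; simp only [Pi.add_apply]; ring
  map_smul' r f := by ext σ; simp only [Pi.smul_apply, smul_eq_mul, RingHom.id_apply]; ring

lemma siteMean_apply (q : ℝ) (k : ℕ) (f : Config a b → ℝ) (σ : Config a b) :
    siteMean q k f σ = q * f (put k false σ) + (1 - q) * f (put k true σ) := rfl

lemma indepOf_siteMean (q : ℝ) (k : ℕ) (f : Config a b → ℝ) : IndepOf k (siteMean q k f) := by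
  intro v σ
  simp only [siteMean_apply, put_put]

lemma IndepOf.siteMean {j : ℕ} {f : Config a b → ℝ} (hf : IndepOf j f) (q : ℝ) (k : ℕ) :
    IndepOf j (siteMean q k f) := by
  intro v σ
  by_cases h : k = j
  · subst h; exact indepOf_siteMean q k f v σ
  · simp only [siteMean_apply, put_comm h, hf v]

lemma IndepOf.siteMean_mul {k : ℕ} {g : Config a b → ℝ} (hg : IndepOf k g) (q : ℝ)
    (f : Config a b → ℝ) : EastModel.siteMean q k (g * f) = g * EastModel.siteMean q k f := by
  ext σ
  simp only [siteMean_apply, Pi.mul_apply, hg _ σ]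
  ring

lemma IndepOf.siteMean_eq {k : ℕ} {g : Config a b → ℝ} (hg : IndepOf k g) (q : ℝ) :
    EastModel.siteMean q k g = g := by
  ext σ
  simp only [siteMean_apply, hg _ σ]
  ring

lemma siteMean_comm (q : ℝ) {j k : ℕ} (h : j ≠ k) (f : Config a b → ℝ) :
    siteMean q j (siteMean q k f) = siteMean q k (siteMean q j f) := by
  ext σ
  simp only [siteMean_apply, put_comm h]
  ring

lemma siteMean_mono {q : ℝ} (hq0 : 0 ≤ q) (hq1 : q ≤ 1) (k : ℕ) {f g : Config a b → ℝ}
    (h : f ≤ g) : siteMean q k f ≤ siteMean q k g := fun σ =>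
  add_le_add (mul_le_mul_of_nonneg_left (h _) hq0)
    (mul_le_mul_of_nonneg_left (h _) (by linarith))

lemma mean_siteMean (q : ℝ) (k : ℕ) (f : Config a b → ℝ) :
    mean q (siteMean q k f) = mean q f := by
  by_cases hk : ∃ x : Finset.Icc a b, x.1 = b - k
  · obtain ⟨x, hx⟩ := hk
    have h : ∀ σ, weight q σ * siteMean q k f σ = weight q σ * f σ +
        (weight q σ * flipRate q σ x * f (flip σ x) - weight q σ * flipRate q σ x * f σ) := by
      intro σ
      rw [siteMean_apply, put_eq_update hx, put_eq_update hx, flipRate, flip]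
      cases hs : σ x
      · have : Function.update σ x false = σ := by rw [← hs, Function.update_eq_self]
        simp [this]; ring
      · have : Function.update σ x true = σ := by rw [← hs, Function.update_eq_self]
        simp [this]; ring
    simp only [mean, h, Finset.sum_add_distrib, Finset.sum_sub_distrib,
      sum_weight_mul_flipRate_flip, sub_self, add_zero]
  · refine congrArg _ (IndepOf.siteMean_eq (fun v σ => congrArg f ?_) q)
    ext y
    have : y.1 ≠ b - k := fun h => hk ⟨y, h⟩
    simp [put, this]

/-- Prescribing the value at a site costs at most a factor `1 / min q (1 - q)` in mean. -/
lemma mean_comp_put_le {q m : ℝ} (hm : 0 < m) (hmq : m ≤ q) (hmp : m ≤ 1 - q) (k : ℕ) (v : Bool)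
    {f : Config a b → ℝ} (hf : ∀ σ, 0 ≤ f σ) :
    m * mean q (fun σ => f (put k v σ)) ≤ mean q f := by
  rw [← mean_siteMean q k f, ← mean_const_mul]
  refine mean_mono (by linarith) (by linarith) fun σ => ?_
  have h0 := hf (put k false σ)
  have h1 := hf (put k true σ)
  rw [siteMean_apply]
  cases v <;> nlinarith

/-- The average over the values at the sites `b - k + 1, …, b`. -/
def tailMean (q : ℝ) : ℕ → (Config a b → ℝ) →ₗ[ℝ] (Config a b → ℝ)
  | 0 => LinearMap.id
  | k + 1 => siteMean q k ∘ₗ tailMean q k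

lemma tailMean_zero (q : ℝ) (f : Config a b → ℝ) : tailMean q 0 f = f := rfl

lemma tailMean_succ (q : ℝ) (k : ℕ) (f : Config a b → ℝ) :
    tailMean q (k + 1) f = siteMean q k (tailMean q k f) := rfl

lemma indepOf_tailMean (q : ℝ) {j k : ℕ} (h : j < k) (f : Config a b → ℝ) :
    IndepOf j (tailMean q k f) := by
  induction k with
  | zero => omega
  | succ k ih =>
    rcases Nat.lt_succ_iff_lt_or_eq.mp h with h | rfl
    · exact (ih h).siteMean q k
    · exact indepOf_siteMean q _ _

lemma tailMean_mul (q : ℝ) {k : ℕ} {g : Config a b → ℝ} (hg : ∀ j < k, IndepOf j g)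
    (f : Config a b → ℝ) : tailMean q k (g * f) = g * tailMean q k f := by
  induction k with
  | zero => rfl
  | succ k ih =>
    rw [tailMean_succ, tailMean_succ, ih fun j hj => hg j (by omega),
      (hg k (by omega)).siteMean_mul]

lemma tailMean_eq_self (q : ℝ) {k : ℕ} {g : Config a b → ℝ} (hg : ∀ j < k, IndepOf j g) :
    tailMean q k g = g := by
  induction k with
  | zero => rfl
  | succ k ih =>
    rw [tailMean_succ, ih fun j hj => hg j (by omega), (hg k (by omega)).siteMean_eq]

lemma tailMean_siteMean (q : ℝ) {j k : ℕ} (h : k ≤ j) (f : Config a b → ℝ) :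
    tailMean q k (siteMean q j f) = siteMean q j (tailMean q k f) := by
  induction k with
  | zero => rfl
  | succ k ih =>
    rw [tailMean_succ, ih (by omega), siteMean_comm q (by omega), tailMean_succ]

lemma tailMean_tailMean (q : ℝ) {i k : ℕ} (h : i ≤ k) (f : Config a b → ℝ) :
    tailMean q k (tailMean q i f) = tailMean q k f := by
  induction k, h using Nat.le_induction with
  | base => exact tailMean_eq_self q fun j hj => indepOf_tailMean q hj f
  | succ k hk ih => rw [tailMean_succ, ih, tailMean_succ]

lemma tailMean_mono {q : ℝ} (hq0 : 0 ≤ q) (hq1 : q ≤ 1) (k : ℕ) {f g : Config a b → ℝ}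
    (h : f ≤ g) : tailMean q k f ≤ tailMean q k g := by
  induction k with
  | zero => exact h
  | succ k ih => exact siteMean_mono hq0 hq1 k ih

lemma mean_tailMean (q : ℝ) (k : ℕ) (f : Config a b → ℝ) :
    mean q (tailMean q k f) = mean q f := by
  induction k with
  | zero => rfl
  | succ k ih => rw [tailMean_succ, mean_siteMean, ih]

/-- The Cauchy–Schwarz inequality for the positive functional `f ↦ tailMean q k f σ`. -/
lemma tailMean_mul_sq_le {q : ℝ} (hq0 : 0 ≤ q) (hq1 : q ≤ 1) (k : ℕ) (f g : Config a b → ℝ)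
    (σ : Config a b) :
    tailMean q k (f * g) σ ^ 2 ≤ tailMean q k (f ^ 2) σ * tailMean q k (g ^ 2) σ := by
  have h : ∀ t : ℝ, 0 ≤ tailMean q k (f ^ 2) σ * (t * t) + 2 * tailMean q k (f * g) σ * t +
      tailMean q k (g ^ 2) σ := by
    intro t
    have h0 : (0 : Config a b → ℝ) ≤ (t • f + g) ^ 2 := fun τ => sq_nonneg _
    have h1 := tailMean_mono hq0 hq1 k h0 σ
    have h2 : (t • f + g) ^ 2 = (t * t) • f ^ 2 + (2 * t) • (f * g) + g ^ 2 := by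
      ext τ
      simp only [Pi.pow_apply, Pi.add_apply, Pi.smul_apply, Pi.mul_apply, smul_eq_mul]
      ring
    rw [h2] at h1
    simp only [map_zero, map_add, map_smul, Pi.zero_apply, Pi.add_apply, Pi.smul_apply,
      smul_eq_mul] at h1
    linarith
  have := discrim_le_zero h
  rw [discrim] at this
  nlinarith

/-! ### Variance decomposition along the averages over the right end -/

lemma mean_sq_tailMean_le {q : ℝ} (hq0 : 0 ≤ q) (hq1 : q ≤ 1) (k : ℕ) (f : Config a b → ℝ) :
    mean q (tailMean q k f ^ 2) ≤ mean q (f ^ 2) := by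
  rw [← mean_tailMean q k (f ^ 2)]
  refine mean_mono hq0 hq1 fun σ => ?_
  have h := tailMean_mul_sq_le hq0 hq1 k f 1 σ
  have h1 : tailMean q k ((1 : Config a b → ℝ) ^ 2) = 1 := by
    rw [one_pow]
    exact tailMean_eq_self q fun j _ v σ => rfl
  rw [h1, mul_one] at h
  simpa using h

/-- Pythagoras for the orthogonal projection `siteMean q k` of `L²(π_Λ)`. -/
lemma mean_sq_sub_siteMean (q : ℝ) (k : ℕ) (f : Config a b → ℝ) :
    mean q ((f - siteMean q k f) ^ 2) = mean q (f ^ 2) - mean q (siteMean q k f ^ 2) := by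
  have h1 : mean q (siteMean q k f * f) = mean q (siteMean q k f ^ 2) := by
    rw [← mean_siteMean q k, (indepOf_siteMean q k f).siteMean_mul, pow_two]
  have h2 : (f - siteMean q k f) ^ 2 = fun σ =>
      ((f ^ 2) σ - 2 * (siteMean q k f * f) σ) + (siteMean q k f ^ 2) σ := by
    ext σ
    simp only [Pi.pow_apply, Pi.sub_apply, Pi.mul_apply]
    ring
  rw [h2, mean_add, mean_sub, mean_const_mul]
  change mean q (f ^ 2) - 2 * mean q (siteMean q k f * f) + mean q (siteMean q k f ^ 2) = _
  rw [h1]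
  ring

lemma antitone_mean_sq_tailMean {q : ℝ} (hq0 : 0 ≤ q) (hq1 : q ≤ 1) (f : Config a b → ℝ) :
    Antitone fun k => mean q (tailMean q k f ^ 2) := by
  refine antitone_nat_of_succ_le fun k => ?_
  have h := mean_sq_sub_siteMean q k (tailMean q k f)
  have h2 : 0 ≤ mean q ((tailMean q k f - siteMean q k (tailMean q k f)) ^ 2) :=
    mean_nonneg hq0 hq1 fun σ => sq_nonneg _
  rw [tailMean_succ]
  linarith

lemma tailMean_eq_mean (q : ℝ) {n : ℕ} (hn : b - a < n) (f : Config a b → ℝ) (σ : Config a b) :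
    tailMean q n f σ = mean q f := by
  have hconst : ∀ τ, tailMean q n f τ = tailMean q n f σ := by
    intro τ
    have h : ∀ s : Finset (Finset.Icc a b),
        tailMean q n f (s.piecewise τ σ) = tailMean q n f σ := by
      intro s
      induction s using Finset.induction_on with
      | empty => rw [Finset.piecewise_empty]
      | insert x s _ ih =>
        have hx := Finset.mem_Icc.mp x.2
        rw [Finset.piecewise_insert, ← put_eq_update (k := (b - x.1).toNat) (by omega),
          indepOf_tailMean q (by omega), ih]
    have h2 := h Finset.univ
    rwa [Finset.piecewise_univ] at h2
  rw [← mean_tailMean q n f, ← mean_const (a := a) (b := b) q (tailMean q n f σ)]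
  exact congrArg _ (funext fun τ => (hconst τ).symm)

lemma variance_eq (q : ℝ) (f : Config a b → ℝ) :
    variance q f = mean q (f ^ 2) - mean q f ^ 2 := by
  have h : (fun σ => (f σ - mean q f) ^ 2) =
      fun σ => ((f ^ 2) σ - (2 * mean q f) * f σ) + mean q f ^ 2 := by
    ext σ
    simp only [Pi.pow_apply]
    ring
  rw [variance, h, mean_add, mean_sub, mean_const_mul, mean_const]
  change mean q (f ^ 2) - _ + _ = _
  ring

lemma variance_eq_mean_sq_tailMean_sub (q : ℝ) {n : ℕ} (hn : b - a < n) (f : Config a b → ℝ) :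
    variance q f = mean q (tailMean q 0 f ^ 2) - mean q (tailMean q n f ^ 2) := by
  have h : tailMean q n f ^ 2 = fun _ => mean q f ^ 2 := by
    ext σ
    rw [Pi.pow_apply, tailMean_eq_mean q hn]
  rw [h, mean_const, tailMean_zero, variance_eq]

/-! ### A Poincaré inequality for long-range constraints -/

open Classical in
/-- The indicator of the event that the `m` sites `b - j`, `i ≤ j < i + m`, all belong to the
interval and are occupied. -/
def fullRun (i m : ℕ) (σ : Config a b) : ℝ :=
  if ∀ j, i ≤ j → j < i + m → Occupied j σ then 1 else 0

lemma fullRun_nonneg (i m : ℕ) (σ : Config a b) : 0 ≤ fullRun i m σ := by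
  rw [fullRun]; split_ifs <;> norm_num

lemma indepOf_fullRun {i m k : ℕ} (hk : k < i ∨ i + m ≤ k) :
    IndepOf k (fullRun (a := a) (b := b) i m) := by
  intro v σ
  have h : (∀ j, i ≤ j → j < i + m → Occupied j (put k v σ)) ↔
      ∀ j, i ≤ j → j < i + m → Occupied j σ :=
    forall₃_congr fun j h1 h2 => occupied_put_of_ne (by omega) v σ
  classical
  rw [fullRun, fullRun]
  exact if_congr h rfl rfl

lemma tailMean_fullRun_le {q : ℝ} (hq1 : q ≤ 1) (i m : ℕ) (σ : Config a b) :
    tailMean q (i + m) (fullRun i m) σ ≤ (1 - q) ^ m := by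
  induction m generalizing σ with
  | zero =>
    have h : fullRun (a := a) (b := b) i 0 = 1 := by
      ext σ
      rw [fullRun, if_pos (fun j h1 h2 => by omega)]
      rfl
    rw [h, tailMean_eq_self q fun j _ v σ => rfl]
    simp
  | succ m ih =>
    have h : fullRun (a := a) (b := b) i (m + 1) = fullRun (i + m) 1 * fullRun i m := by
      ext σ
      have h : (∀ j, i ≤ j → j < i + (m + 1) → Occupied j σ) ↔
          (∀ j, i + m ≤ j → j < i + m + 1 → Occupied j σ) ∧
            ∀ j, i ≤ j → j < i + m → Occupied j σ := by
        refine ⟨fun h => ⟨fun j h1 h2 => h j (by omega) (by omega),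
          fun j h1 h2 => h j h1 (by omega)⟩, fun h j h1 h2 => ?_⟩
        by_cases hj : j < i + m
        · exact h.2 j h1 hj
        · exact h.1 j (by omega) (by omega)
      simp only [fullRun, Pi.mul_apply, h]
      split_ifs <;> simp_all
    have h0 : fullRun (i + m) 1 (put (i + m) false σ) = 0 := by
      rw [fullRun, if_neg]
      exact fun h => not_occupied_put_false _ σ (h _ le_rfl (by omega))
    have h1 : fullRun (i + m) 1 (put (i + m) true σ) ≤ 1 := by
      rw [fullRun]; split_ifs <;> norm_num
    have h2 := ih (put (i + m) true σ)
    have h3 := fullRun_nonneg (i + m) 1 (put (i + m) true σ)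
    have h4 : (0 : ℝ) ≤ (1 - q) ^ m := pow_nonneg (by linarith) m
    rw [← add_assoc, tailMean_succ, h, tailMean_mul q fun j hj => indepOf_fullRun (by omega),
      siteMean_apply, Pi.mul_apply, Pi.mul_apply, h0, pow_succ]
    have h5 : fullRun (i + m) 1 (put (i + m) true σ) *
        tailMean q (i + m) (fullRun i m) (put (i + m) true σ) ≤ (1 - q) ^ m :=
      (mul_le_mul_of_nonneg_left h2 h3).trans (mul_le_of_le_one_left h4 h1)
    nlinarith [mul_le_mul_of_nonneg_left h5 (by linarith : (0 : ℝ) ≤ 1 - q)]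

/-- The indicator of the event that there is no empty site within distance `L` to the right of
the site `b - k`, where all sites to the right of the interval are regarded as empty. -/
def blocked (L k : ℕ) : Config a b → ℝ := if L ≤ k then fullRun (k - L) L else 0

lemma blocked_sq (L k : ℕ) : (blocked (a := a) (b := b) L k) ^ 2 = blocked L k := by
  ext σ
  rw [blocked]
  split_ifs
  · rw [Pi.pow_apply, fullRun]; split_ifs <;> norm_num
  · simp

lemma indepOf_blocked {L k j : ℕ} (hj : j < k - L ∨ k ≤ j) :
    IndepOf j (blocked (a := a) (b := b) L k) := by
  rw [blocked]
  split_ifs with h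
  · exact indepOf_fullRun (by omega)
  · exact fun v σ => rfl

lemma tailMean_blocked_le {q : ℝ} (hq1 : q ≤ 1) (L k : ℕ) (σ : Config a b) :
    tailMean q k (blocked L k) σ ≤ (1 - q) ^ L := by
  rw [blocked]
  split_ifs with h
  · have := tailMean_fullRun_le hq1 (k - L) L σ
    rwa [Nat.sub_add_cancel h] at this
  · rw [map_zero]
    exact pow_nonneg (by linarith) L

/-- One term of the variance decomposition. The part of `f - siteMean q k f` on which the
long-range constraint at `b - k` fails is, after averaging over the sites to the right, controlled
by the terms for the sites within distance `L`, with the probability of the failure in front. -/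
lemma mean_sq_tailMean_sub_le {q : ℝ} (hq0 : 0 ≤ q) (hq1 : q ≤ 1) (L k : ℕ)
    (f : Config a b → ℝ) :
    mean q (tailMean q k f ^ 2) - mean q (tailMean q (k + 1) f ^ 2) ≤
      2 * mean q (((1 - blocked L k) * (f - siteMean q k f)) ^ 2) + 2 * (1 - q) ^ L *
        (mean q (tailMean q (k - L) f ^ 2) - mean q (tailMean q (k + 1) f ^ 2)) := by
  set B : Config a b → ℝ := blocked L k with hB
  set h := tailMean q (k - L) f with hh
  set u := tailMean q k ((1 - B) * (f - siteMean q k f)) with hu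
  set v := tailMean q k (B * (f - siteMean q k f)) with hv
  have hsplit : tailMean q k f - siteMean q k (tailMean q k f) = u + v := by
    rw [← tailMean_siteMean q le_rfl, ← map_sub, hu, hv, ← map_add]
    congr 1
    ring
  have h1 : mean q (u ^ 2) ≤ mean q (((1 - B) * (f - siteMean q k f)) ^ 2) :=
    mean_sq_tailMean_le hq0 hq1 k _
  -- `B` depends only on the sites `b - j` with `k - L ≤ j < k`, so the rest can be averaged out.
  have hv2 : v = tailMean q k (B * (h - siteMean q k h)) := by
    rw [hv, ← tailMean_tailMean q (Nat.sub_le k L),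
      tailMean_mul q fun j hj => indepOf_blocked (Or.inl hj), map_sub,
      tailMean_siteMean q (Nat.sub_le k L)]
  have h2 : mean q (v ^ 2) ≤ (1 - q) ^ L * mean q ((h - siteMean q k h) ^ 2) := by
    rw [← mean_tailMean q k ((h - siteMean q k h) ^ 2), ← mean_const_mul]
    refine mean_mono hq0 hq1 fun σ => ?_
    rw [hv2, Pi.pow_apply]
    refine (tailMean_mul_sq_le hq0 hq1 k _ _ σ).trans ?_
    rw [hB, blocked_sq]
    refine mul_le_mul_of_nonneg_right (tailMean_blocked_le hq1 L k σ) ?_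
    have h0 : (0 : Config a b → ℝ) ≤ (h - siteMean q k h) ^ 2 := fun τ => sq_nonneg _
    simpa using tailMean_mono hq0 hq1 k h0 σ
  have h3 : mean q (tailMean q (k + 1) f ^ 2) ≤ mean q (siteMean q k h ^ 2) := by
    rw [tailMean_succ, ← tailMean_tailMean q (Nat.sub_le k L) f, ← tailMean_siteMean q le_rfl]
    exact mean_sq_tailMean_le hq0 hq1 k _
  have h4 := mean_sq_sub_siteMean q k h
  have h5 : mean q ((u + v) ^ 2) ≤ 2 * mean q (u ^ 2) + 2 * mean q (v ^ 2) := by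
    rw [← mean_const_mul, ← mean_const_mul, ← mean_add]
    refine mean_mono hq0 hq1 fun σ => ?_
    simp only [Pi.pow_apply, Pi.add_apply]
    nlinarith [sq_nonneg (u σ - v σ)]
  have h6 : (0 : ℝ) ≤ (1 - q) ^ L := pow_nonneg (by linarith) L
  rw [tailMean_succ, ← mean_sq_sub_siteMean, hsplit]
  rw [← tailMean_succ]
  nlinarith [mul_le_mul_of_nonneg_left h3 h6]

lemma sum_sub_shift_le {A : ℕ → ℝ} (hA : Antitone A) (L n : ℕ) :
    ∑ k ∈ Finset.range n, (A (k - L) - A (k + 1)) ≤ (L + 1) * (A 0 - A n) := by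
  induction L with
  | zero =>
    simp only [Nat.sub_zero, Finset.sum_range_sub', Nat.cast_zero, zero_add, one_mul, le_refl]
  | succ L ih =>
    have h : ∀ n : ℕ, ∑ k ∈ Finset.range n, (A (k - (L + 1)) - A (k - L)) =
        A 0 - A (n - (L + 1)) := by
      intro n
      induction n with
      | zero => simp
      | succ n ih => rw [Finset.sum_range_succ, ih, Nat.add_sub_add_right]; ring
    have h2 : ∑ k ∈ Finset.range n, (A (k - (L + 1)) - A (k + 1)) =
        ∑ k ∈ Finset.range n, (A (k - (L + 1)) - A (k - L)) +
          ∑ k ∈ Finset.range n, (A (k - L) - A (k + 1)) := by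
      rw [← Finset.sum_add_distrib]
      exact Finset.sum_congr rfl fun k _ => by ring
    rw [h2, h]
    have h3 : A n ≤ A (n - (L + 1)) := hA (Nat.sub_le _ _)
    push_cast
    linarith

/-- The Poincaré inequality for the long-range constraints: sites may be updated when there is an
empty site within distance `L` to the right, and constraints fail so rarely that their failures
can be absorbed. -/
lemma variance_le_of_blocked {q : ℝ} (hq0 : 0 ≤ q) (hq1 : q ≤ 1) {L : ℕ}
    (hL : 2 * (L + 1) * (1 - q) ^ L ≤ 1 / 2) {n : ℕ} (hn : b - a < n) (f : Config a b → ℝ) :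
    variance q f ≤ 4 * ∑ k ∈ Finset.range n,
      mean q (((1 - blocked L k) * (f - siteMean q k f)) ^ 2) := by
  have h1 := Finset.sum_le_sum fun k (_ : k ∈ Finset.range n) =>
    mean_sq_tailMean_sub_le hq0 hq1 L k f
  rw [Finset.sum_range_sub' fun k => mean q (tailMean q k f ^ 2), Finset.sum_add_distrib,
    ← Finset.mul_sum, ← Finset.mul_sum, ← variance_eq_mean_sq_tailMean_sub q hn] at h1
  have h2 := sum_sub_shift_le (antitone_mean_sq_tailMean hq0 hq1 f) L n
  rw [← variance_eq_mean_sq_tailMean_sub q hn] at h2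
  have h3 : (0 : ℝ) ≤ (1 - q) ^ L := pow_nonneg (by linarith) L
  have h4 : 0 ≤ variance q f := mean_nonneg hq0 hq1 fun σ => sq_nonneg _
  nlinarith [mul_le_mul_of_nonneg_left h2 h3, mul_le_mul_of_nonneg_right hL h4]

/-! ### From long-range constraints to the East constraint -/

open Classical in
/-- The energy of flipping the site `b - k` while the site at distance `j` to its right is empty;
all sites to the right of the interval are regarded as empty. -/
def rangeEnergy (q : ℝ) (f : Config a b → ℝ) (k j : ℕ) : ℝ :=
  mean q fun σ => if j ≤ k ∧ Occupied (k - j) σ then 0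
    else (f (put k true σ) - f (put k false σ)) ^ 2

lemma rangeEnergy_nonneg {q : ℝ} (hq0 : 0 ≤ q) (hq1 : q ≤ 1) (f : Config a b → ℝ) (k j : ℕ) :
    0 ≤ rangeEnergy q f k j :=
  mean_nonneg hq0 hq1 fun σ => by split_ifs <;> positivity

lemma sq_sub_siteMean_le {q : ℝ} (hq0 : 0 ≤ q) (hq1 : q ≤ 1) (k : ℕ) (f : Config a b → ℝ)
    (σ : Config a b) :
    (f σ - siteMean q k f σ) ^ 2 ≤ (f (put k true σ) - f (put k false σ)) ^ 2 := by
  rw [siteMean_apply]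
  set d := f (put k true σ) - f (put k false σ) with hd
  rcases put_self k σ with h | h
  · rw [h] at hd ⊢
    have : f σ - (q * f (put k false σ) + (1 - q) * f σ) = q * d := by rw [hd]; ring
    rw [this, mul_pow]
    exact mul_le_of_le_one_left (sq_nonneg d) (pow_le_one₀ hq0 hq1)
  · rw [h] at hd ⊢
    have : f σ - (q * f σ + (1 - q) * f (put k true σ)) = -((1 - q) * d) := by rw [hd]; ring
    rw [this, neg_sq, mul_pow]
    exact mul_le_of_le_one_left (sq_nonneg d) (pow_le_one₀ (by linarith) (by linarith))

lemma mean_unblocked_le {q : ℝ} (hq0 : 0 ≤ q) (hq1 : q ≤ 1) {L : ℕ} (hL : 1 ≤ L) (k : ℕ)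
    (f : Config a b → ℝ) :
    mean q (((1 - blocked L k) * (f - siteMean q k f)) ^ 2) ≤
      ∑ j ∈ Finset.Icc 1 L, rangeEnergy q f k j := by
  classical
  have hsum : ∑ j ∈ Finset.Icc 1 L, rangeEnergy q f k j =
      mean q fun σ => ∑ j ∈ Finset.Icc 1 L, if j ≤ k ∧ Occupied (k - j) σ then 0
        else (f (put k true σ) - f (put k false σ)) ^ 2 := by
    simp only [rangeEnergy, mean, Finset.mul_sum]
    rw [Finset.sum_comm]
  rw [hsum]
  refine mean_mono hq0 hq1 fun σ => ?_
  have hterm : ∀ j ∈ Finset.Icc 1 L, (0 : ℝ) ≤ if j ≤ k ∧ Occupied (k - j) σ then 0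
      else (f (put k true σ) - f (put k false σ)) ^ 2 := fun j _ => by
    split_ifs <;> positivity
  have hnb : (1 - blocked L k σ = 0) ∨ (1 - blocked L k σ = 1 ∧
      ∃ j ∈ Finset.Icc 1 L, ¬ (j ≤ k ∧ Occupied (k - j) σ)) := by
    rw [blocked]
    split_ifs with h
    · rw [fullRun]
      split_ifs with h2
      · left; norm_num
      · right
        push Not at h2
        obtain ⟨i, h3, h4, h5⟩ := h2
        refine ⟨by norm_num, k - i, Finset.mem_Icc.mpr ⟨by omega, by omega⟩, ?_⟩
        rw [show k - (k - i) = i by omega]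
        exact fun h6 => h5 h6.2
    · exact Or.inr ⟨by simp, L, Finset.mem_Icc.mpr ⟨hL, le_rfl⟩, fun h2 => h h2.1⟩
  simp only [Pi.pow_apply, Pi.mul_apply, Pi.sub_apply, Pi.one_apply]
  rcases hnb with h | ⟨h, j, hj, hj2⟩
  · rw [h, zero_mul, zero_pow two_ne_zero]
    exact Finset.sum_nonneg hterm
  · rw [h, one_mul]
    refine (sq_sub_siteMean_le hq0 hq1 k f σ).trans ?_
    have := Finset.single_le_sum hterm hj
    rwa [if_neg hj2] at this

/-- To flip the site `b - (k + 1)`, first empty its right neighbour `b - k` with the help of a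
more distant empty site, then flip, then restore the neighbour. -/
lemma rangeEnergy_succ_succ_le {q m : ℝ} (hm : 0 < m) (hmq : m ≤ q) (hmp : m ≤ 1 - q)
    (f : Config a b → ℝ) (k j : ℕ) :
    m * rangeEnergy q f (k + 1) (j + 1) ≤
      3 * (2 * rangeEnergy q f k j + rangeEnergy q f (k + 1) 1) := by
  classical
  set d : ℕ → Config a b → ℝ := fun k σ => (f (put k true σ) - f (put k false σ)) ^ 2 with hd
  set F : ℕ → ℕ → Config a b → ℝ :=
    fun k j σ => if j ≤ k ∧ Occupied (k - j) σ then 0 else d k σ with hF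
  have hFmean : ∀ k j, rangeEnergy q f k j = mean q (F k j) := by
    intro k j
    rw [rangeEnergy, hF]
  have hF0 : ∀ k j σ, 0 ≤ F k j σ := fun k j σ => by
    simp only [hF, hd]; split_ifs <;> positivity
  have hpt : ∀ σ, F (k + 1) (j + 1) σ ≤ 3 * ((F k j (put (k + 1) true σ) +
      F k j (put (k + 1) false σ)) + F (k + 1) 1 (put k false σ)) := by
    intro σ
    by_cases hz : j ≤ k ∧ Occupied (k - j) σ
    · have : F (k + 1) (j + 1) σ = 0 := by
        simp only [hF]
        rw [if_pos ⟨by omega, by rw [Nat.add_sub_add_right]; exact hz.2⟩]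
      rw [this]
      have h1 := hF0 k j (put (k + 1) true σ)
      have h2 := hF0 k j (put (k + 1) false σ)
      have h3 := hF0 (k + 1) 1 (put k false σ)
      positivity
    · have h0 : F (k + 1) (j + 1) σ = d (k + 1) σ := by
        simp only [hF]
        rw [if_neg]
        rw [Nat.add_sub_add_right]
        exact fun h => hz ⟨by omega, h.2⟩
      have h1 : ∀ v, F k j (put (k + 1) v σ) = d k (put (k + 1) v σ) := by
        intro v
        simp only [hF]
        rw [if_neg]
        rwa [occupied_put_of_ne (by omega)]
      have h2 : F (k + 1) 1 (put k false σ) = d (k + 1) (put k false σ) := by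
        simp only [hF]
        rw [if_neg]
        exact fun h => not_occupied_put_false k σ h.2
      have h3 : ∀ v, (f (put (k + 1) v σ) - f (put (k + 1) v (put k false σ))) ^ 2 ≤
          d k (put (k + 1) v σ) := by
        intro v
        simp only [hd]
        rw [put_comm (j := k + 1) (k := k) (by omega)]
        rcases put_self k (put (k + 1) v σ) with h | h
        · rw [h]
        · rw [h, sub_self, zero_pow two_ne_zero]
          exact sq_nonneg _
      -- The increment `A + G - B` is taken along the path with the site `b - k` emptied.
      rw [h0, h1, h1, h2]
      have h4 := h3 true
      have h5 := h3 false
      set A := f (put (k + 1) true σ) - f (put (k + 1) true (put k false σ)) with hA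
      set B := f (put (k + 1) false σ) - f (put (k + 1) false (put k false σ)) with hB
      have h6 : d (k + 1) (put k false σ) = (f (put (k + 1) true (put k false σ)) -
        f (put (k + 1) false (put k false σ))) ^ 2 := rfl
      set G := f (put (k + 1) true (put k false σ)) - f (put (k + 1) false (put k false σ)) with hG
      have h7 : d (k + 1) σ = (A + G - B) ^ 2 := by
        simp only [hd, hA, hB, hG]; ring
      rw [h6, h7]
      nlinarith [sq_nonneg (A - G), sq_nonneg (A + B), sq_nonneg (G + B)]
  rw [hFmean, hFmean, hFmean]
  have h1 := mean_comp_put_le hm hmq hmp (k + 1) true (hF0 k j)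
  have h2 := mean_comp_put_le hm hmq hmp (k + 1) false (hF0 k j)
  have h3 := mean_comp_put_le hm hmq hmp k false (hF0 (k + 1) 1)
  have h4 := mean_mono (by linarith) (by linarith) hpt (q := q)
  rw [mean_const_mul, mean_add, mean_add] at h4
  nlinarith

lemma sum_rangeEnergy_le {q m : ℝ} (hm : 0 < m) (hmq : m ≤ q) (hmp : m ≤ 1 - q)
    (f : Config a b → ℝ) (n j : ℕ) :
    ∑ k ∈ Finset.range n, rangeEnergy q f k (j + 1) ≤
      (9 / m) ^ j * ∑ k ∈ Finset.range n, rangeEnergy q f k 1 := by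
  have hq0 : 0 ≤ q := by linarith
  have hq1 : q ≤ 1 := by linarith
  have hm1 : 1 ≤ 9 / m := by rw [le_div_iff₀ hm]; linarith
  have hnn : ∀ j, ∀ k ∈ Finset.range n, 0 ≤ rangeEnergy q f k j :=
    fun j k _ => rangeEnergy_nonneg hq0 hq1 f k j
  set S := ∑ k ∈ Finset.range n, rangeEnergy q f k 1 with hS
  have hS0 : 0 ≤ S := Finset.sum_nonneg (hnn 1)
  induction j with
  | zero => simp [hS]
  | succ j ih =>
    have h1 : ∀ k ∈ Finset.range n, m * rangeEnergy q f k (j + 1 + 1) ≤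
        3 * (2 * (if 0 < k then rangeEnergy q f (k - 1) (j + 1) else 0) +
          rangeEnergy q f k 1) := by
      intro k hk
      cases k with
      | zero =>
        have h0 : rangeEnergy q f 0 (j + 1 + 1) = rangeEnergy q f 0 1 := by simp [rangeEnergy]
        rw [h0]
        have := hnn 1 0 hk
        simp only [lt_irrefl, if_false]
        nlinarith
      | succ k =>
        simpa using rangeEnergy_succ_succ_le hm hmq hmp f k (j + 1)
    have h2 : ∑ k ∈ Finset.range n, (if 0 < k then rangeEnergy q f (k - 1) (j + 1) else 0) ≤
        ∑ k ∈ Finset.range n, rangeEnergy q f k (j + 1) := by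
      cases n with
      | zero => simp
      | succ n =>
        rw [Finset.sum_range_succ', Finset.sum_range_succ]
        simpa using rangeEnergy_nonneg hq0 hq1 f n (j + 1)
    have h3 := Finset.sum_le_sum h1
    rw [← Finset.mul_sum, ← Finset.mul_sum, Finset.sum_add_distrib, ← Finset.mul_sum] at h3
    have h4 : S ≤ (9 / m) ^ j * S := le_mul_of_one_le_left hS0 (one_le_pow₀ hm1)
    rw [pow_succ, mul_right_comm, mul_div_assoc', le_div_iff₀ hm]
    linarith

lemma constraint_eq (σ : Config a b) (x : Finset.Icc a b) [Decidable (1 ≤ (b - x.1).toNat ∧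
    Occupied ((b - x.1).toNat - 1) σ)] :
    constraint σ x =
      if 1 ≤ (b - x.1).toNat ∧ Occupied ((b - x.1).toNat - 1) σ then 0 else 1 := by
  have hx := Finset.mem_Icc.mp x.2
  rw [constraint]
  by_cases h : x.1 < b
  · rw [dif_pos h]
    have hocc : Occupied ((b - x.1).toNat - 1) σ ↔
        σ ⟨x.1 + 1, Finset.mem_Icc.mpr ⟨by omega, by omega⟩⟩ = true := by
      constructor
      · rintro ⟨y, hy, h2⟩
        have : y = ⟨x.1 + 1, Finset.mem_Icc.mpr ⟨by omega, by omega⟩⟩ :=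
          Subtype.ext (by simp only; omega)
        rwa [this] at h2
      · exact fun h2 => ⟨_, by simp only; omega, h2⟩
    have : 1 ≤ (b - x.1).toNat := by omega
    simp only [this, true_and, hocc]
  · have : ¬ 1 ≤ (b - x.1).toNat := by omega
    rw [dif_neg h, if_neg fun h2 => this h2.1]

lemma sq_sub_put_eq_sq_sub_flip (f : Config a b → ℝ) (σ : Config a b) (x : Finset.Icc a b) {k : ℕ}
    (hx : x.1 = b - k) :
    (f (put k true σ) - f (put k false σ)) ^ 2 = (f (flip σ x) - f σ) ^ 2 := by
  rw [put_eq_update hx, put_eq_update hx, flip]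
  cases h : σ x
  · have : Function.update σ x false = σ := by rw [← h, Function.update_eq_self]
    rw [this]
    rfl
  · have : Function.update σ x true = σ := by rw [← h, Function.update_eq_self]
    rw [this, sub_sq_comm]
    rfl

lemma flipRate_ge {q m : ℝ} (hmq : m ≤ q) (hmp : m ≤ 1 - q) (σ : Config a b)
    (x : Finset.Icc a b) : m ≤ flipRate q σ x := by
  rw [flipRate]; split_ifs <;> assumption

lemma sum_rangeEnergy_one_le {q m : ℝ} (hm : 0 < m) (hmq : m ≤ q) (hmp : m ≤ 1 - q)
    (f : Config a b → ℝ) :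
    m * ∑ k ∈ Finset.range (b + 1 - a).toNat, rangeEnergy q f k 1 ≤ 2 * dirichlet q f f := by
  classical
  have h1 : ∑ k ∈ Finset.range (b + 1 - a).toNat, rangeEnergy q f k 1 =
      ∑ x : Finset.Icc a b, rangeEnergy q f (b - x.1).toNat 1 := by
    symm
    refine Finset.sum_bij (fun x _ => (b - x.1).toNat) ?_ ?_ ?_ fun _ _ => rfl
    · intro x _
      have hx := Finset.mem_Icc.mp x.2
      exact Finset.mem_range.mpr (by omega)
    · intro x _ y _ h
      have hx := Finset.mem_Icc.mp x.2
      have hy := Finset.mem_Icc.mp y.2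
      exact Subtype.ext (by omega)
    · intro k hk
      have := Finset.mem_range.mp hk
      exact ⟨⟨b - k, Finset.mem_Icc.mpr ⟨by omega, by omega⟩⟩, Finset.mem_univ _,
        by simp only; omega⟩
  rw [h1, dirichlet, ← mul_assoc, Finset.mul_sum]
  norm_num1
  rw [one_mul]
  refine Finset.sum_le_sum fun x _ => ?_
  have hx := Finset.mem_Icc.mp x.2
  rw [rangeEnergy, mean, Finset.mul_sum]
  refine Finset.sum_le_sum fun σ _ => ?_
  rw [constraint_eq, sq_sub_put_eq_sq_sub_flip f σ x (by omega)]
  have h2 := weight_nonneg (q := q) (by linarith) (by linarith) σ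
  have h3 := flipRate_ge hmq hmp σ x
  split_ifs
  · simp
  · have h4 := mul_nonneg h2 (sq_nonneg (f (flip σ x) - f σ))
    nlinarith [mul_le_mul_of_nonneg_left h3 h4]

theorem exists_variance_le {q : ℝ} (hq0 : 0 < q) (hq1 : q < 1) :
    ∃ C : ℝ, 0 < C ∧ ∀ a b : ℤ, a ≤ b → ∀ f : Config a b → ℝ,
      variance q f ≤ C * dirichlet q f f := by
  obtain ⟨L, hL1, hL⟩ : ∃ L : ℕ, 1 ≤ L ∧ 2 * ((L : ℝ) + 1) * (1 - q) ^ L ≤ 1 / 2 := by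
    have h1 := tendsto_self_mul_const_pow_of_lt_one (r := 1 - q) (by linarith) (by linarith)
    have h2 := tendsto_pow_atTop_nhds_zero_of_lt_one (r := 1 - q) (by linarith) (by linarith)
    have h3 := (h1.add h2).eventually_le_const (u := 1 / 4) (by norm_num)
    obtain ⟨L, hL, hL1⟩ := (h3.and (Filter.eventually_ge_atTop 1)).exists
    exact ⟨L, hL1, by linarith⟩
  obtain ⟨m, hm, hmq, hmp⟩ : ∃ m : ℝ, 0 < m ∧ m ≤ q ∧ m ≤ 1 - q :=
    ⟨min q (1 - q), lt_min hq0 (by linarith), min_le_left _ _, min_le_right _ _⟩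
  refine ⟨4 * (∑ j ∈ Finset.Icc 1 L, (9 / m) ^ (j - 1)) * (2 / m), ?_, fun a b hab f => ?_⟩
  · have : 0 < ∑ j ∈ Finset.Icc 1 L, (9 / m) ^ (j - 1) :=
      Finset.sum_pos (fun j _ => by positivity) ⟨1, Finset.mem_Icc.mpr ⟨le_rfl, hL1⟩⟩
    positivity
  · set n := (b + 1 - a).toNat with hn
    have h1 := variance_le_of_blocked hq0.le hq1.le hL (a := a) (b := b) (n := n) (by omega) f
    have h2 := Finset.sum_le_sum fun k (_ : k ∈ Finset.range n) =>
      mean_unblocked_le hq0.le hq1.le hL1 k f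
    rw [Finset.sum_comm] at h2
    have h3 : ∑ j ∈ Finset.Icc 1 L, ∑ k ∈ Finset.range n, rangeEnergy q f k j ≤
        (∑ j ∈ Finset.Icc 1 L, (9 / m) ^ (j - 1)) *
          ∑ k ∈ Finset.range n, rangeEnergy q f k 1 := by
      rw [Finset.sum_mul]
      refine Finset.sum_le_sum fun j hj => ?_
      have hj1 := (Finset.mem_Icc.mp hj).1
      have := sum_rangeEnergy_le hm hmq hmp f n (j - 1)
      rwa [Nat.sub_add_cancel hj1] at this
    have h4 : ∑ k ∈ Finset.range n, rangeEnergy q f k 1 ≤ 2 / m * dirichlet q f f := by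
      rw [div_mul_eq_mul_div, le_div_iff₀ hm, mul_comm]
      exact sum_rangeEnergy_one_le hm hmq hmp f
    have h5 : 0 ≤ ∑ j ∈ Finset.Icc 1 L, (9 / m) ^ (j - 1) :=
      Finset.sum_nonneg fun j _ => by positivity
    nlinarith [mul_le_mul_of_nonneg_left h4 h5]

/-! ### The integrand of the energy -/

lemma sinh_mul_le {r y : ℝ} (hr0 : 0 ≤ r) (hr1 : r ≤ 1) (hy : 0 ≤ y) :
    Real.sinh (r * y) ≤ r * Real.sinh y := by
  have hd : ∀ y, HasDerivAt (fun y => r * Real.sinh y - Real.sinh (r * y))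
      (r * Real.cosh y - Real.cosh (r * y) * (r * 1)) y := fun y =>
    ((Real.hasDerivAt_sinh y).const_mul r).sub (((hasDerivAt_id y).const_mul r).sinh)
  have hm : MonotoneOn (fun y => r * Real.sinh y - Real.sinh (r * y)) (Set.Ici 0) := by
    refine monotoneOn_of_deriv_nonneg (convex_Ici 0)
      (fun y _ => (hd y).continuousAt.continuousWithinAt)
      (fun y _ => (hd y).differentiableAt.differentiableWithinAt) fun y hy => ?_
    rw [interior_Ici] at hy
    have hy : 0 < y := hy
    have : Real.cosh (r * y) ≤ Real.cosh y := by
      rw [Real.cosh_le_cosh, abs_of_nonneg (by positivity), abs_of_pos hy]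
      nlinarith
    rw [(hd y).deriv]
    nlinarith
  have := hm (Set.mem_Ici.mpr le_rfl) (Set.mem_Ici.mpr hy) hy
  simp only [mul_zero, Real.sinh_zero, sub_zero] at this
  linarith

lemma sinh_le_mul_cosh {y : ℝ} (hy : 0 ≤ y) : Real.sinh y ≤ y * Real.cosh y := by
  have hd : ∀ y, HasDerivAt (fun y => y * Real.cosh y - Real.sinh y)
      (1 * Real.cosh y + y * Real.sinh y - Real.cosh y) y := fun y =>
    ((hasDerivAt_id y).mul (Real.hasDerivAt_cosh y)).sub (Real.hasDerivAt_sinh y)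
  have hm : MonotoneOn (fun y => y * Real.cosh y - Real.sinh y) (Set.Ici 0) := by
    refine monotoneOn_of_deriv_nonneg (convex_Ici 0)
      (fun y _ => (hd y).continuousAt.continuousWithinAt)
      (fun y _ => (hd y).differentiableAt.differentiableWithinAt) fun y hy => ?_
    rw [interior_Ici] at hy
    have hy : 0 < y := hy
    rw [(hd y).deriv]
    nlinarith [Real.sinh_pos_iff.mpr hy]
  have := hm (Set.mem_Ici.mpr le_rfl) (Set.mem_Ici.mpr hy) hy
  simp only [zero_mul, Real.sinh_zero, sub_zero] at this
  linarith

lemma cosh_sub_one_eq (x : ℝ) : Real.cosh x - 1 = 2 * Real.sinh (|x| / 2) ^ 2 := by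
  have h1 := Real.cosh_two_mul (|x| / 2)
  have h2 := Real.cosh_sq (|x| / 2)
  rw [show 2 * (|x| / 2) = |x| by ring, Real.cosh_abs] at h1
  linarith

lemma cosh_mul_sub_one_le {r : ℝ} (hr0 : 0 ≤ r) (hr1 : r ≤ 1) (x : ℝ) :
    Real.cosh (r * x) - 1 ≤ r ^ 2 * (Real.cosh x - 1) := by
  have h0 : (0 : ℝ) ≤ |x| / 2 := by positivity
  have h1 := sinh_mul_le hr0 hr1 h0
  have h2 : 0 ≤ Real.sinh (r * (|x| / 2)) := Real.sinh_nonneg_iff.mpr (by positivity)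
  rw [cosh_sub_one_eq, cosh_sub_one_eq, abs_mul, abs_of_nonneg hr0, mul_div_assoc]
  nlinarith [pow_le_pow_left₀ h2 h1 2]

lemma sq_mul_cosh_sub_one_le {r : ℝ} (hr1 : 1 ≤ r) (x : ℝ) :
    r ^ 2 * (Real.cosh x - 1) ≤ Real.cosh (r * x) - 1 := by
  have hr0 : 0 < r := by linarith
  have h := cosh_mul_sub_one_le (inv_nonneg.mpr hr0.le) (inv_le_one_of_one_le₀ hr1) (r * x)
  rw [inv_mul_cancel_left₀ hr0.ne', inv_pow] at h
  calc r ^ 2 * (Real.cosh x - 1) ≤ r ^ 2 * ((r ^ 2)⁻¹ * (Real.cosh (r * x) - 1)) := by gcongr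
    _ = _ := by field_simp

/-- The integrand of the energy in the `α`-log-Sobolev inequality, for a transition between
configurations at which the function has the values `u` and `v`. -/
def alphaIntegrand (α u v : ℝ) : ℝ :=
  if α = 1 then (1 / 4) * ((u - v) * (Real.log u - Real.log v))
  else α * (α / (α - 1)) / 4 *
    ((u ^ (1 / α) - v ^ (1 / α)) * (u ^ (1 / (α / (α - 1))) - v ^ (1 / (α / (α - 1)))))

lemma alphaEnergy_eq (q α : ℝ) (f : Config a b → ℝ) :
    alphaEnergy q α f = (1 / 2) * ∑ x, ∑ σ, weight q σ * constraint σ x * flipRate q σ x *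
      alphaIntegrand α (f (flip σ x)) (f σ) := by
  rw [alphaEnergy]
  split_ifs with h <;>
  · simp only [alphaIntegrand, h, if_true, if_false, dirichlet, Finset.mul_sum]
    refine Finset.sum_congr rfl fun x _ => Finset.sum_congr rfl fun σ _ => ?_
    ring

lemma alphaIntegrand_mul {α t u v : ℝ} (hα : 0 < α) (ht : 0 < t) (hu : 0 < u) (hv : 0 < v) :
    alphaIntegrand α (t * u) (t * v) = t * alphaIntegrand α u v := by
  rw [alphaIntegrand, alphaIntegrand]
  split_ifs with h
  · rw [Real.log_mul ht.ne' hu.ne', Real.log_mul ht.ne' hv.ne']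
    ring
  · have h1 : t ^ (1 / α) * t ^ (1 / (α / (α - 1))) = t := by
      rw [← Real.rpow_add ht]
      have : 1 / α + 1 / (α / (α - 1)) = 1 := by field_simp; ring
      rw [this, Real.rpow_one]
    simp only [Real.mul_rpow ht.le hu.le, Real.mul_rpow ht.le hv.le]
    linear_combination (α * (α / (α - 1)) / 4 * ((u ^ (1 / α) - v ^ (1 / α)) *
      (u ^ (1 / (α / (α - 1))) - v ^ (1 / (α / (α - 1)))))) * h1

lemma alphaIntegrand_comm (α u v : ℝ) : alphaIntegrand α u v = alphaIntegrand α v u := by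
  rw [alphaIntegrand, alphaIntegrand]
  split_ifs <;> ring

lemma alphaIntegrand_self (α u : ℝ) : alphaIntegrand α u u = 0 := by
  simp [alphaIntegrand]

/-- The Stroock–Varopoulos inequality: the integrand is smallest for `α = 2`. With
`u = e^(A+x)`, `v = e^(A-x)` and `r = 2 / α - 1` the integrand equals
`2 e^A (cosh x - cosh (r x)) / (1 - r²)`, with the limit `e^A x sinh x` for `α = 1`. -/
lemma sq_sqrt_sub_sqrt_le_alphaIntegrand {α u v : ℝ} (hα0 : 0 < α) (hα2 : α ≤ 2) (hu : 0 < u)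
    (hv : 0 < v) : (√u - √v) ^ 2 ≤ alphaIntegrand α u v := by
  obtain ⟨A, x, rfl, rfl⟩ : ∃ A x : ℝ, u = Real.exp (A + x) ∧ v = Real.exp (A - x) :=
    ⟨(Real.log u + Real.log v) / 2, (Real.log u - Real.log v) / 2,
      by rw [← add_div, add_add_sub_cancel, add_self_div_two, Real.exp_log hu],
      by rw [← sub_div, add_sub_sub_cancel, add_self_div_two, Real.exp_log hv]⟩
  have hA := Real.exp_pos A
  have hl : (√(Real.exp (A + x)) - √(Real.exp (A - x))) ^ 2 =
      Real.exp A * (2 * (Real.cosh x - 1)) := by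
    have h1 : √(Real.exp (A + x)) * √(Real.exp (A - x)) = Real.exp A := by
      rw [← Real.sqrt_mul (Real.exp_pos _).le, ← Real.exp_add,
        show A + x + (A - x) = A + A by ring, Real.exp_add, Real.sqrt_mul_self hA.le]
    rw [sub_sq, Real.sq_sqrt (Real.exp_pos _).le, Real.sq_sqrt (Real.exp_pos _).le, mul_assoc, h1,
      Real.cosh_eq, Real.exp_add, sub_eq_add_neg A x, Real.exp_add]
    ring
  rw [hl, alphaIntegrand]
  split_ifs with h
  · have h1 : 1 / 4 * ((Real.exp (A + x) - Real.exp (A - x)) *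
        (Real.log (Real.exp (A + x)) - Real.log (Real.exp (A - x)))) =
        Real.exp A * (|x| * Real.sinh |x|) := by
      have h2 : |x| * Real.sinh |x| = x * Real.sinh x := by
        rcases abs_cases x with h | h <;> rw [h.1]
        rw [Real.sinh_neg]; ring
      rw [h2, Real.log_exp, Real.log_exp, Real.sinh_eq, Real.exp_add, sub_eq_add_neg A x,
        Real.exp_add]
      ring
    rw [h1]
    refine mul_le_mul_of_nonneg_left ?_ hA.le
    have h3 : (0 : ℝ) ≤ |x| / 2 := by positivity
    have h4 := sinh_le_mul_cosh h3
    have h5 := Real.sinh_nonneg_iff.mpr h3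
    have h6 := Real.sinh_two_mul (|x| / 2)
    rw [show 2 * (|x| / 2) = |x| by ring] at h6
    rw [cosh_sub_one_eq, h6]
    nlinarith
  · set r := 2 / α - 1 with hr
    have hs : 1 / α = (1 + r) / 2 := by rw [hr]; field_simp; ring
    have ht : 1 / (α / (α - 1)) = (1 - r) / 2 := by rw [hr]; field_simp; ring
    have hα1 : α - 1 ≠ 0 := sub_ne_zero.mpr h
    have hr1 : 1 - r ^ 2 ≠ 0 := by
      have : 1 - r ^ 2 = 4 * (α - 1) / α ^ 2 := by rw [hr]; field_simp; ring
      rw [this]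
      positivity
    have hc : α * (α / (α - 1)) / 4 = 1 / (1 - r ^ 2) := by
      have : 1 - r ^ 2 = 4 * (α - 1) / α ^ 2 := by rw [hr]; field_simp; ring
      rw [this]
      field_simp
    have hprod : (Real.exp (A + x) ^ ((1 + r) / 2) - Real.exp (A - x) ^ ((1 + r) / 2)) *
        (Real.exp (A + x) ^ ((1 - r) / 2) - Real.exp (A - x) ^ ((1 - r) / 2)) =
        Real.exp A * (2 * (Real.cosh x - Real.cosh (r * x))) := by
      have h1 : Real.exp A * (2 * (Real.cosh x - Real.cosh (r * x))) =
          Real.exp (A + x) + Real.exp (A - x) - Real.exp (A + r * x) - Real.exp (A - r * x) := by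
        simp only [Real.cosh_eq, Real.exp_add, sub_eq_add_neg]
        ring
      rw [h1]
      simp only [← Real.exp_mul, sub_mul, mul_sub, ← Real.exp_add]
      ring_nf
    rw [hs, ht, hc, hprod]
    have hr0 : 0 ≤ r := by
      rw [hr, sub_nonneg, le_div_iff₀ hα0]; linarith
    have key : 2 * (Real.cosh x - 1) ≤
        1 / (1 - r ^ 2) * (2 * (Real.cosh x - Real.cosh (r * x))) := by
      rw [one_div_mul_eq_div]
      rcases le_total r 1 with h1 | h1
      · have h2 : 0 < 1 - r ^ 2 := lt_of_le_of_ne (by nlinarith) hr1.symm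
        rw [le_div_iff₀ h2]
        nlinarith [cosh_mul_sub_one_le hr0 h1 x]
      · have h2 : 1 - r ^ 2 < 0 := lt_of_le_of_ne (by nlinarith) hr1
        rw [le_div_iff_of_neg h2]
        nlinarith [sq_mul_cosh_sub_one_le h1 x]
    calc _ ≤ Real.exp A * (1 / (1 - r ^ 2) * (2 * (Real.cosh x - Real.cosh (r * x)))) :=
          mul_le_mul_of_nonneg_left key hA.le
      _ = _ := by ring

lemma constraint_nonneg (σ : Config a b) (x : Finset.Icc a b) : 0 ≤ constraint σ x := by
  rw [constraint]; split_ifs <;> norm_num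

lemma dirichlet_sqrt_le_alphaEnergy {q α : ℝ} (hq0 : 0 ≤ q) (hq1 : q ≤ 1) (hα0 : 0 < α)
    (hα2 : α ≤ 2) {f : Config a b → ℝ} (hf : ∀ σ, 0 < f σ) :
    dirichlet q (fun σ => √(f σ)) (fun σ => √(f σ)) ≤ alphaEnergy q α f := by
  rw [alphaEnergy_eq, dirichlet]
  refine mul_le_mul_of_nonneg_left (Finset.sum_le_sum fun x _ => Finset.sum_le_sum fun σ _ => ?_)
    (by norm_num)
  rw [mul_assoc _ (_ - _) (_ - _), ← pow_two]
  refine mul_le_mul_of_nonneg_left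
    (sq_sqrt_sub_sqrt_le_alphaIntegrand hα0 hα2 (hf _) (hf _)) ?_
  exact mul_nonneg (mul_nonneg (weight_nonneg hq0 hq1 σ) (constraint_nonneg σ x))
    (flipRate_ge (m := 0) hq0 (by linarith) σ x)

/-! ### Entropy and variance -/

/-- The left side vanishes to second order at `u = 1`, and for `u ≥ 2` the bound `L` on `log u`
does the rest. -/
lemma sq_mul_log_sq_le {u L : ℝ} (hu : 0 < u) (hL0 : 0 ≤ L) (hL : Real.log u ≤ L) :
    u ^ 2 * Real.log (u ^ 2) - u ^ 2 + 1 ≤ (5 + 8 * L) * (u - 1) ^ 2 := by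
  rw [Real.log_pow]
  push_cast
  rcases le_total u 2 with h | h
  · have h1 : Real.log u ≤ u - 1 := Real.log_le_sub_one_of_pos hu
    have h2 : u ^ 2 * (2 * Real.log u) ≤ u ^ 2 * (2 * (u - 1)) := by gcongr
    have h3 : 0 ≤ L * (u - 1) ^ 2 := by positivity
    have h4 : (2 * u + 1) * (u - 1) ^ 2 ≤ 5 * (u - 1) ^ 2 := by gcongr; linarith
    nlinarith
  · have h2 : u ^ 2 * (2 * Real.log u) ≤ u ^ 2 * (2 * L) := by gcongr
    have h3 : 2 * u ^ 2 ≤ 8 * (u - 1) ^ 2 := by nlinarith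
    have h4 := mul_le_mul_of_nonneg_right h3 hL0
    nlinarith [sq_nonneg (u - 1)]

lemma mean_pos {q : ℝ} (hq0 : 0 < q) (hq1 : q < 1) {f : Config a b → ℝ} (hf : ∀ σ, 0 < f σ) :
    0 < mean q f := by
  refine Finset.sum_pos (fun σ _ => mul_pos ?_ (hf σ)) Finset.univ_nonempty
  exact Finset.prod_pos fun x _ => by split_ifs <;> linarith

/-- One half of the variational formula for the entropy: `t = π_Λ(f)` is optimal. -/
lemma entropy_le_mean {q : ℝ} (hq0 : 0 < q) (hq1 : q < 1) {f : Config a b → ℝ}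
    (hf : ∀ σ, 0 < f σ) {t : ℝ} (ht : 0 < t) :
    entropy q f ≤ mean q fun σ => f σ * Real.log (f σ / t) - f σ + t := by
  have hM := mean_pos hq0 hq1 hf
  set M := mean q f with hMdef
  have h1 : (fun σ => f σ * Real.log (f σ / t) - f σ + t) =
      fun σ => (f σ * Real.log (f σ / M) + (Real.log M - Real.log t - 1) * f σ) + t := by
    ext σ
    rw [Real.log_div (hf σ).ne' ht.ne', Real.log_div (hf σ).ne' hM.ne']
    ring
  have h2 := Real.log_le_sub_one_of_pos (div_pos ht hM)
  rw [Real.log_div ht.ne' hM.ne'] at h2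
  have h3 := mul_le_mul_of_nonneg_right h2 hM.le
  rw [sub_mul, sub_mul, div_mul_cancel₀ _ hM.ne'] at h3
  rw [h1, mean_add, mean_add, mean_const_mul, mean_const, ← hMdef, entropy]
  nlinarith

/-- Entropy is bounded by variance up to the logarithm of the largest relative value of `g`. -/
lemma entropy_sq_le {q : ℝ} (hq0 : 0 < q) (hq1 : q < 1) {g : Config a b → ℝ}
    (hg : ∀ σ, 0 < g σ) {L : ℝ} (hL0 : 0 ≤ L) (hL : ∀ σ, Real.log (g σ / mean q g) ≤ L) :
    entropy q (fun σ => g σ ^ 2) ≤ (5 + 8 * L) * variance q g := by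
  have hM := mean_pos hq0 hq1 hg
  refine (entropy_le_mean hq0 hq1 (fun σ => pow_pos (hg σ) 2) (pow_pos hM 2)).trans ?_
  rw [variance, ← mean_const_mul]
  refine mean_mono hq0.le hq1.le fun σ => ?_
  set M := mean q g with hMdef
  have h := mul_le_mul_of_nonneg_right
    (sq_mul_log_sq_le (div_pos (hg σ) hM) hL0 (hL σ)) (sq_nonneg M)
  calc _ = ((g σ / M) ^ 2 * Real.log ((g σ / M) ^ 2) - (g σ / M) ^ 2 + 1) * M ^ 2 := by
        rw [← div_pow]; field_simp
    _ ≤ _ := h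
    _ = _ := by field_simp

lemma log_div_mean_le {q m : ℝ} (hm : 0 < m) (hmq : m ≤ q) (hmp : m ≤ 1 - q)
    {g : Config a b → ℝ} (hg : ∀ σ, 0 < g σ) (σ : Config a b) :
    Real.log (g σ / mean q g) ≤ ((Finset.Icc a b).card : ℝ) * -Real.log m := by
  have h1 : m ^ (Finset.Icc a b).card ≤ weight q σ := by
    rw [weight, ← Fintype.card_coe, ← Finset.card_univ, ← Finset.prod_const]
    exact Finset.prod_le_prod (fun _ _ => hm.le) fun x _ => by split_ifs <;> assumption
  have h2 : weight q σ * g σ ≤ mean q g :=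
    Finset.single_le_sum (f := fun τ => weight q τ * g τ)
      (fun τ _ => mul_nonneg (weight_nonneg (by linarith) (by linarith) τ) (hg τ).le)
      (Finset.mem_univ σ)
  have h3 : 0 < m ^ (Finset.Icc a b).card * g σ := mul_pos (pow_pos hm _) (hg σ)
  have h4 := Real.log_le_log h3 ((mul_le_mul_of_nonneg_right h1 (hg σ).le).trans h2)
  rw [Real.log_mul (pow_pos hm _).ne' (hg σ).ne', Real.log_pow] at h4
  rw [Real.log_div (hg σ).ne' (mean_pos (by linarith) (by linarith) hg).ne']
  linarith

theorem exists_entropy_le {q : ℝ} (hq0 : 0 < q) (hq1 : q < 1) :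
    ∃ K : ℝ, 0 < K ∧ ∀ α : ℝ, 0 < α → α ≤ 2 → ∀ a b : ℤ, a ≤ b →
      K * ((Finset.Icc a b).card : ℝ) ∈ alphaLogSobolevConstants q α a b := by
  obtain ⟨C, hC, hP⟩ := exists_variance_le hq0 hq1
  obtain ⟨m, hm, hmq, hmp⟩ : ∃ m : ℝ, 0 < m ∧ m ≤ q ∧ m ≤ 1 - q :=
    ⟨min q (1 - q), lt_min hq0 (by linarith), min_le_left _ _, min_le_right _ _⟩
  have hlog : 0 ≤ -Real.log m := neg_nonneg.mpr (Real.log_nonpos hm.le (by linarith))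
  refine ⟨(5 + 8 * -Real.log m) * C, by positivity, fun α hα0 hα2 a b hab => ?_⟩
  have hn : (1 : ℝ) ≤ ((Finset.Icc a b).card : ℝ) := by
    exact_mod_cast Finset.card_pos.mpr (Finset.nonempty_Icc.mpr hab)
  refine ⟨by positivity, fun f hf => ?_⟩
  set n := ((Finset.Icc a b).card : ℝ)
  have hg : ∀ σ, 0 < √(f σ) := fun σ => Real.sqrt_pos.mpr (hf σ)
  have h1 := entropy_sq_le hq0 hq1 hg (L := n * -Real.log m) (by positivity)
    (log_div_mean_le hm hmq hmp hg)
  simp only [Real.sq_sqrt (hf _).le] at h1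
  have h2 := hP a b hab fun σ => √(f σ)
  have h3 := dirichlet_sqrt_le_alphaEnergy hq0.le hq1.le hα0 hα2 hf
  have hV : 0 ≤ variance q fun σ => √(f σ) := mean_nonneg hq0.le hq1.le fun σ => sq_nonneg _
  calc entropy q f ≤ (5 + 8 * (n * -Real.log m)) * variance q (fun σ => √(f σ)) := h1
    _ ≤ ((5 + 8 * -Real.log m) * n) * variance q (fun σ => √(f σ)) := by
        gcongr; nlinarith
    _ ≤ ((5 + 8 * -Real.log m) * n) * (C * alphaEnergy q α f) := by
        gcongr; exact h2.trans (mul_le_mul_of_nonneg_left h3 hC.le)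
    _ = _ := by ring

/-! ### A test function driven by the occupied sites at the left end -/

/-- The maximal run of occupied sites starting at the left end of the interval. -/
def leadingRun (σ : Config a b) : Finset (Finset.Icc a b) :=
  Finset.univ.filter fun x => ∀ y ≤ x, σ y = true

lemma mem_leadingRun {σ : Config a b} {x : Finset.Icc a b} :
    x ∈ leadingRun σ ↔ ∀ y ≤ x, σ y = true := by
  simp [leadingRun]

lemma card_filter_val_lt {z : ℤ} (hz : z ≤ b + 1) :
    (Finset.univ.filter fun x : Finset.Icc a b => x.1 < z).card = (z - a).toNat := by
  rw [← Int.card_Ico, ← Finset.card_map (Function.Embedding.subtype _)]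
  congr 1
  ext y
  simp only [Finset.mem_map, Finset.mem_filter, Finset.mem_univ, true_and,
    Function.Embedding.subtype_apply, Finset.mem_Ico]
  constructor
  · rintro ⟨x, hx, rfl⟩
    exact ⟨(Finset.mem_Icc.mp x.2).1, hx⟩
  · rintro ⟨h1, h2⟩
    exact ⟨⟨y, Finset.mem_Icc.mpr ⟨h1, by omega⟩⟩, h2, rfl⟩

/-- The sites at distance less than the length of the leading run from the left end are
occupied. -/
lemma eq_true_of_lt_card_leadingRun {σ : Config a b} {x : Finset.Icc a b}
    (hx : x.1 < a + (leadingRun σ).card) : σ x = true := by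
  by_contra h
  have hsub : leadingRun σ ⊆ Finset.univ.filter fun y : Finset.Icc a b => y.1 < x.1 := by
    intro y hy
    rw [mem_leadingRun] at hy
    refine Finset.mem_filter.mpr ⟨Finset.mem_univ y, ?_⟩
    by_contra h2
    exact h (hy x (not_lt.mp h2))
  have h1 := Finset.card_le_card hsub
  have h2 := Finset.mem_Icc.mp x.2
  rw [card_filter_val_lt (by omega)] at h1
  omega

lemma card_leadingRun_le (σ : Config a b) : (leadingRun σ).card ≤ (Finset.Icc a b).card := by
  rw [← Fintype.card_coe (Finset.Icc a b)]
  exact Finset.card_le_univ _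

lemma exists_eq_false_of_constraint {σ : Config a b} {x z : Finset.Icc a b}
    (hc : constraint σ x ≠ 0) (hz : x < z) : ∃ y, x < y ∧ y ≤ z ∧ σ y = false := by
  have hz' : x.1 < z.1 := hz
  have h1 := Finset.mem_Icc.mp x.2
  have h2 := Finset.mem_Icc.mp z.2
  rw [constraint, dif_pos (by omega)] at hc
  refine ⟨⟨x.1 + 1, Finset.mem_Icc.mpr ⟨by omega, by omega⟩⟩, ?_, ?_, by simpa using hc⟩
  · exact Subtype.mk_lt_mk.mpr (by simp)
  · exact Subtype.mk_le_mk.mpr (by omega)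

lemma leadingRun_of_false {σ : Config a b} {x : Finset.Icc a b} (h : ∀ y < x, σ y = true)
    (hx : σ x = false) : leadingRun σ = Finset.univ.filter (· < x) := by
  ext z
  simp only [mem_leadingRun, Finset.mem_filter, Finset.mem_univ, true_and]
  refine ⟨fun hz => ?_, fun hz y hy => h y (hy.trans_lt hz)⟩
  by_contra h2
  have := hz x (not_lt.mp h2)
  simp [hx] at this

lemma leadingRun_of_true {σ : Config a b} {x : Finset.Icc a b} (hc : constraint σ x ≠ 0)
    (h : ∀ y < x, σ y = true) (hx : σ x = true) :
    leadingRun σ = insert x (Finset.univ.filter (· < x)) := by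
  ext z
  simp only [mem_leadingRun, Finset.mem_insert, Finset.mem_filter, Finset.mem_univ, true_and]
  rw [← le_iff_eq_or_lt]
  refine ⟨fun hz => ?_, fun hz y hy => ?_⟩
  · by_contra h2
    obtain ⟨y, -, hy2, hy3⟩ := exists_eq_false_of_constraint hc (not_le.mp h2)
    have := hz y hy2
    simp [hy3] at this
  · rcases (hy.trans hz).lt_or_eq with h2 | rfl
    · exact h y h2
    · exact hx

lemma flip_apply_of_ne {σ : Config a b} {x y : Finset.Icc a b} (h : y ≠ x) :
    flip σ x y = σ y := by
  simp [flip, h]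

lemma flip_apply_self (σ : Config a b) (x : Finset.Icc a b) : flip σ x x = !σ x := by
  simp [flip]

lemma constraint_flip (σ : Config a b) (x : Finset.Icc a b) :
    constraint (flip σ x) x = constraint σ x := by
  rw [constraint, constraint]
  split_ifs with h <;> simp_all [flip, Subtype.ext_iff]

lemma card_leadingRun_of_true {σ : Config a b} {x : Finset.Icc a b} (hc : constraint σ x ≠ 0)
    (h : ∀ y < x, σ y = true) (hx : σ x = true) :
    (leadingRun σ).card = (leadingRun (flip σ x)).card + 1 := by
  have h2 : ∀ y < x, flip σ x y = true := fun y hy => by rw [flip_apply_of_ne hy.ne, h y hy]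
  rw [leadingRun_of_true hc h hx, leadingRun_of_false h2 (by rw [flip_apply_self, hx]; rfl),
    Finset.card_insert_of_notMem (by simp)]

lemma card_leadingRun_of_false {σ : Config a b} {x : Finset.Icc a b} (hc : constraint σ x ≠ 0)
    (h : ∀ y < x, σ y = true) (hx : σ x = false) :
    (leadingRun (flip σ x)).card = (leadingRun σ).card + 1 := by
  have h2 : ∀ y < x, flip σ x y = true := fun y hy => by rw [flip_apply_of_ne hy.ne, h y hy]
  have h3 := card_leadingRun_of_true (σ := flip σ x) (by rwa [constraint_flip]) h2
    (by rw [flip_apply_self, hx]; rfl)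
  rwa [flip_flip] at h3

lemma leadingRun_flip_of_not {σ : Config a b} {x : Finset.Icc a b}
    (h : ¬ ∀ y < x, σ y = true) : leadingRun (flip σ x) = leadingRun σ := by
  push Not at h
  obtain ⟨w, hw, hw2⟩ := h
  ext z
  rw [mem_leadingRun, mem_leadingRun]
  by_cases hz : w ≤ z
  · exact iff_of_false (fun h => hw2 (by rw [← h w hz, flip_apply_of_ne hw.ne]))
      fun h => hw2 (h w hz)
  · exact forall₂_congr fun y hy => by
      rw [flip_apply_of_ne ((hy.trans_lt (not_le.mp hz)).trans hw).ne]

lemma card_filter_leading_true_le (σ : Config a b) [DecidablePred fun x : Finset.Icc a b =>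
    constraint σ x ≠ 0 ∧ (∀ y < x, σ y = true) ∧ σ x = true] :
    (Finset.univ.filter fun x : Finset.Icc a b =>
      constraint σ x ≠ 0 ∧ (∀ y < x, σ y = true) ∧ σ x = true).card ≤ 1 := by
  have key : ∀ x z : Finset.Icc a b, constraint σ x ≠ 0 → (∀ y < z, σ y = true) → σ z = true →
      ¬ x < z := by
    intro x z hc h hz hxz
    obtain ⟨y, -, hy2, hy3⟩ := exists_eq_false_of_constraint hc hxz
    rcases hy2.lt_or_eq with h2 | rfl
    · simp [h y h2] at hy3
    · simp [hz] at hy3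
  refine Finset.card_le_one.mpr fun x hx z hz => ?_
  have hx := (Finset.mem_filter.mp hx).2
  have hz := (Finset.mem_filter.mp hz).2
  exact le_antisymm (not_lt.mp (key z x hz.1 hx.2.1 hx.2.2))
    (not_lt.mp (key x z hx.1 hz.2.1 hz.2.2))

lemma card_filter_leading_false_le (σ : Config a b) [DecidablePred fun x : Finset.Icc a b =>
    constraint σ x ≠ 0 ∧ (∀ y < x, σ y = true) ∧ σ x = false] :
    (Finset.univ.filter fun x : Finset.Icc a b =>
      constraint σ x ≠ 0 ∧ (∀ y < x, σ y = true) ∧ σ x = false).card ≤ 1 := by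
  have key : ∀ x z : Finset.Icc a b, σ x = false → (∀ y < z, σ y = true) → ¬ x < z := by
    intro x z hx h hxz
    simp [h x hxz] at hx
  refine Finset.card_le_one.mpr fun x hx z hz => ?_
  have hx := (Finset.mem_filter.mp hx).2
  have hz := (Finset.mem_filter.mp hz).2
  exact le_antisymm (not_lt.mp (key z x hz.2.2 hx.2.1)) (not_lt.mp (key x z hx.2.2 hz.2.1))

/-- The test function `r ^ h`, with `h` the length of the leading run. -/
def testFunction (r : ℝ) (σ : Config a b) : ℝ := r ^ (leadingRun σ).card

lemma constraint_le_one (σ : Config a b) (x : Finset.Icc a b) : constraint σ x ≤ 1 := by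
  rw [constraint]; split_ifs <;> norm_num

/-- An allowed transition changes `h` by at most one, and changes it at all for at most two sites,
so that the energy of `r ^ h` is at most a constant times its mean. -/
lemma alphaEnergy_testFunction_le {q α r : ℝ} (hq0 : 0 < q) (hq1 : q < 1) (hα0 : 0 < α)
    (hα2 : α ≤ 2) (hr : 1 < r) :
    alphaEnergy q α (testFunction (a := a) (b := b) r) ≤
      alphaIntegrand α r 1 * mean q (testFunction (a := a) (b := b) r) := by
  classical
  have hr0 : 0 < r := by linarith
  set Φ := alphaIntegrand α r 1 with hΦ
  have hΦ0 : 0 ≤ Φ := (sq_nonneg _).trans (sq_sqrt_sub_sqrt_le_alphaIntegrand hα0 hα2 hr0 one_pos)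
  set f : Config a b → ℝ := testFunction r with hf
  have hf0 : ∀ σ, 0 < f σ := fun σ => pow_pos hr0 _
  have hterm : ∀ σ x, constraint σ x * flipRate q σ x * alphaIntegrand α (f (flip σ x)) (f σ) ≤
      (if constraint σ x ≠ 0 ∧ (∀ y < x, σ y = true) ∧ σ x = true then Φ * f σ else 0) +
      (if constraint σ x ≠ 0 ∧ (∀ y < x, σ y = true) ∧ σ x = false then Φ * f σ else 0) := by
    intro σ x
    have hΦf : 0 ≤ Φ * f σ := mul_nonneg hΦ0 (hf0 σ).le
    have hcr : constraint σ x * flipRate q σ x ≤ 1 := by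
      refine mul_le_one₀ (constraint_le_one σ x) (flipRate_ge (m := 0) hq0.le (by linarith) σ x) ?_
      rw [flipRate]; split_ifs <;> linarith
    have hcr0 : 0 ≤ constraint σ x * flipRate q σ x :=
      mul_nonneg (constraint_nonneg σ x) (flipRate_ge (m := 0) hq0.le (by linarith) σ x)
    by_cases hc : constraint σ x = 0
    · simp [hc]
    by_cases h : ∀ y < x, σ y = true
    · cases hx : σ x
      · have h1 : f (flip σ x) = f σ * r := by
          rw [hf, testFunction, testFunction, card_leadingRun_of_false hc h hx, pow_succ]
        have h2 : alphaIntegrand α (f (flip σ x)) (f σ) = f σ * Φ := by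
          have := alphaIntegrand_mul hα0 (hf0 σ) hr0 one_pos
          rwa [mul_one, ← h1] at this
        rw [h2, if_neg (by simp), if_pos ⟨hc, h, rfl⟩, zero_add]
        nlinarith
      · have h1 : f σ = f (flip σ x) * r := by
          rw [hf, testFunction, testFunction, card_leadingRun_of_true hc h hx, pow_succ]
        have h2 : alphaIntegrand α (f (flip σ x)) (f σ) = f (flip σ x) * Φ := by
          have := alphaIntegrand_mul hα0 (hf0 (flip σ x)) one_pos hr0
          rwa [mul_one, ← h1, alphaIntegrand_comm α 1] at this
        have h3 : f (flip σ x) ≤ f σ := by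
          rw [h1]; exact le_mul_of_one_le_right (hf0 _).le hr.le
        rw [h2, if_pos ⟨hc, h, rfl⟩, if_neg (by simp), add_zero]
        have h4 : 0 ≤ f (flip σ x) * Φ := mul_nonneg (hf0 _).le hΦ0
        calc _ ≤ 1 * (f (flip σ x) * Φ) := mul_le_mul_of_nonneg_right hcr h4
          _ ≤ 1 * (f σ * Φ) := by gcongr
          _ = _ := by ring
    · rw [hf, testFunction, testFunction, leadingRun_flip_of_not h, alphaIntegrand_self,
        if_neg fun h2 => h h2.2.1, if_neg fun h2 => h h2.2.1]
      simp
  have hsum : ∀ σ, ∑ x, constraint σ x * flipRate q σ x *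
      alphaIntegrand α (f (flip σ x)) (f σ) ≤ 2 * (Φ * f σ) := by
    intro σ
    have hΦf : 0 ≤ Φ * f σ := mul_nonneg hΦ0 (hf0 σ).le
    refine (Finset.sum_le_sum fun x _ => hterm σ x).trans ?_
    rw [Finset.sum_add_distrib, ← Finset.sum_filter, ← Finset.sum_filter, Finset.sum_const,
      Finset.sum_const, nsmul_eq_mul, nsmul_eq_mul, two_mul]
    exact add_le_add
      (mul_le_of_le_one_left hΦf (by exact_mod_cast card_filter_leading_true_le σ))
      (mul_le_of_le_one_left hΦf (by exact_mod_cast card_filter_leading_false_le σ))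
  rw [alphaEnergy_eq, Finset.sum_comm, mean, Finset.mul_sum, Finset.mul_sum]
  refine Finset.sum_le_sum fun σ _ => ?_
  have h1 := mul_le_mul_of_nonneg_left (hsum σ) (weight_nonneg hq0.le hq1.le σ)
  rw [Finset.mul_sum] at h1
  simp only [← mul_assoc] at h1 ⊢
  linarith

lemma mean_testFunction_le {q r : ℝ} (hq0 : 0 < q) (hq1 : q < 1) (hr : 0 < r) :
    mean q (testFunction (a := a) (b := b) r) ≤
      ∑ j ∈ Finset.range ((Finset.Icc a b).card + 1), ((1 - q) * r) ^ j := by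
  have hpt : ∀ σ : Config a b, testFunction r σ ≤
      ∑ j ∈ Finset.range ((Finset.Icc a b).card + 1), r ^ j * ∏ x : Finset.Icc a b,
        (if x.1 < a + j then (if σ x then 1 else 0) else 1) := by
    intro σ
    have h1 : testFunction r σ = r ^ (leadingRun σ).card * ∏ x : Finset.Icc a b,
        (if x.1 < a + (leadingRun σ).card then (if σ x then 1 else 0) else 1) := by
      rw [Finset.prod_eq_one, mul_one, testFunction]
      intro x _
      split_ifs with h2 h3
      · rfl
      · exact absurd (eq_true_of_lt_card_leadingRun h2) h3
      · rfl
    rw [h1]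
    refine Finset.single_le_sum (f := fun j : ℕ => r ^ j * ∏ x : Finset.Icc a b,
      (if x.1 < a + j then (if σ x then (1 : ℝ) else 0) else 1)) (fun j _ => ?_)
      (Finset.mem_range.mpr (Nat.lt_succ_of_le (card_leadingRun_le σ)))
    exact mul_nonneg (pow_pos hr j).le (Finset.prod_nonneg fun x _ => by split_ifs <;> norm_num)
  refine (mean_mono hq0.le hq1.le hpt).trans (le_of_eq ?_)
  have hlin : ∀ (s : Finset ℕ) (g : ℕ → Config a b → ℝ),
      mean q (fun σ => ∑ j ∈ s, r ^ j * g j σ) = ∑ j ∈ s, r ^ j * mean q (g j) := by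
    intro s g
    simp only [mean, Finset.mul_sum]
    rw [Finset.sum_comm]
    exact Finset.sum_congr rfl fun j _ => Finset.sum_congr rfl fun σ _ => by ring
  rw [hlin]
  refine Finset.sum_congr rfl fun j hj => ?_
  have hj := Finset.mem_range.mp hj
  rw [Int.card_Icc] at hj
  have h1 := mean_prod (a := a) (b := b) q fun x v =>
    if x.1 < a + j then (if v then (1 : ℝ) else 0) else 1
  have h2 : ∀ x : Finset.Icc a b,
      q * (if x.1 < a + (j : ℤ) then (if false = true then (1 : ℝ) else 0) else 1) +
        (1 - q) * (if x.1 < a + (j : ℤ) then (if true = true then (1 : ℝ) else 0) else 1) =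
      if x.1 < a + (j : ℤ) then 1 - q else 1 := by
    intro x
    split_ifs <;> simp_all
  rw [Finset.prod_congr rfl fun x _ => h2 x] at h1
  rw [h1, ← Finset.prod_filter, Finset.prod_const, mul_pow, mul_comm]
  by_cases hab : a ≤ b + 1
  · rw [card_filter_val_lt (by omega)]
    congr
    omega
  · have hj0 : j = 0 := by omega
    subst hj0
    rw [Finset.card_eq_zero.mpr]
    refine Finset.filter_eq_empty_iff.mpr fun x _ h => ?_
    have := Finset.mem_Icc.mp x.2
    push_cast at h
    omega

lemma geom_sum_le {μ : ℝ} (hμ : 1 < μ) (n : ℕ) :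
    ∑ j ∈ Finset.range (n + 1), μ ^ j ≤ μ ^ n * (1 + 1 / (μ - 1)) := by
  have h0 : 0 < μ - 1 := by linarith
  have h1 := geom_sum_mul μ (n + 1)
  have h2 : μ ^ n * (1 + 1 / (μ - 1)) = μ ^ (n + 1) / (μ - 1) := by field_simp; ring
  rw [h2, le_div_iff₀ h0, h1]
  linarith

/-- The entropy of the test function: its mass concentrates on the fully occupied configuration. -/
lemma entropy_testFunction_ge {q μ : ℝ} (hq0 : 0 < q) (hq1 : q < 1) (hμ : 1 < μ) :
    μ ^ (Finset.Icc a b).card * (((Finset.Icc a b).card : ℝ) * (-Real.log (1 - q)) -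
      1 / (μ - 1) * (((Finset.Icc a b).card : ℝ) * Real.log μ) -
      (1 + 1 / (μ - 1)) * (1 / (μ - 1))) ≤
      entropy q (testFunction (a := a) (b := b) (μ / (1 - q))) := by
  have hp : 0 < 1 - q := by linarith
  have hμ0 : 0 < μ := by linarith
  have hδ : 0 < 1 / (μ - 1) := one_div_pos.mpr (by linarith)
  set δ := 1 / (μ - 1) with hδdef
  set n := (Finset.Icc a b).card with hn
  set r := μ / (1 - q) with hr
  have hr1 : 1 < r := by rw [hr, lt_div_iff₀ hp]; linarith
  set f : Config a b → ℝ := testFunction r with hf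
  have hf1 : ∀ σ, 1 ≤ f σ := fun σ => one_le_pow₀ hr1.le
  have hZ1 : 1 ≤ mean q f := by
    have := mean_mono hq0.le hq1.le hf1
    rwa [mean_const] at this
  have hZ0 : 0 < mean q f := by linarith
  have hZ : mean q f ≤ μ ^ n * (1 + δ) := by
    have h1 := mean_testFunction_le (a := a) (b := b) hq0 hq1 (r := r) (by linarith)
    rw [hr, mul_div_cancel₀ _ hp.ne'] at h1
    exact h1.trans (geom_sum_le hμ n)
  have hlogZ : Real.log (mean q f) ≤ n * Real.log μ + δ := by
    have h1 := Real.log_le_log hZ0 hZ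
    rw [Real.log_mul (by positivity) (by positivity), Real.log_pow] at h1
    have h2 := Real.log_le_sub_one_of_pos (show 0 < 1 + δ by positivity)
    linarith
  have hent : entropy q f = mean q (fun σ => f σ * Real.log (f σ)) -
      Real.log (mean q f) * mean q f := by
    rw [entropy, ← mean_const_mul, ← mean_sub]
    congr 1
    ext σ
    rw [Real.log_div (by linarith [hf1 σ]) hZ0.ne']
    ring
  have hmain : μ ^ n * (n * (Real.log μ - Real.log (1 - q))) ≤
      mean q (fun σ => f σ * Real.log (f σ)) := by
    have hone : f (fun _ => true) = r ^ n := by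
      rw [hf, testFunction, leadingRun, Finset.filter_true_of_mem (by simp), Finset.card_univ,
        Fintype.card_coe]
    have hw : weight q (fun _ : Finset.Icc a b => true) = (1 - q) ^ n := by
      rw [weight, Finset.prod_congr rfl fun x _ => if_pos rfl, Finset.prod_const, Finset.card_univ,
        Fintype.card_coe]
    have h1 := Finset.single_le_sum
      (f := fun σ : Config a b => weight q σ * (f σ * Real.log (f σ)))
      (fun σ _ => mul_nonneg (weight_nonneg hq0.le hq1.le σ)
        (mul_nonneg (by linarith [hf1 σ]) (Real.log_nonneg (hf1 σ))))
      (Finset.mem_univ fun _ => true)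
    simp only [hone, hw, Real.log_pow] at h1
    rw [← mul_assoc, ← mul_pow, hr, mul_div_cancel₀ _ hp.ne', Real.log_div hμ0.ne' hp.ne'] at h1
    exact h1
  have hlogμ : 0 < Real.log μ := Real.log_pos hμ
  have h5 : Real.log (mean q f) * mean q f ≤ (n * Real.log μ + δ) * (μ ^ n * (1 + δ)) := by
    gcongr
  rw [hent]
  nlinarith

theorem exists_mul_card_le {q α : ℝ} (hq0 : 0 < q) (hq1 : q < 1) (hα0 : 0 < α) (hα2 : α ≤ 2) :
    ∃ κ : ℝ, 0 < κ ∧ ∀ a b : ℤ, a ≤ b → ∀ C ∈ alphaLogSobolevConstants q α a b,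
      κ * ((Finset.Icc a b).card : ℝ) ≤ C := by
  have hp : 0 < 1 - q := by linarith
  have hℓ : 0 < -Real.log (1 - q) := neg_pos.mpr (Real.log_neg hp (by linarith))
  set ℓ := -Real.log (1 - q) with hℓdef
  -- With `μ = s²` the corrections to the entropy are at most `4 / s ≤ ℓ / 2` per site.
  obtain ⟨s, hs2, hs⟩ : ∃ s : ℝ, 2 ≤ s ∧ 4 / s ≤ ℓ / 2 := by
    refine ⟨2 + 8 / ℓ, by have := div_pos (by norm_num : (0 : ℝ) < 8) hℓ; linarith, ?_⟩
    rw [div_le_iff₀ (by positivity)]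
    field_simp
    nlinarith
  have hμ : 1 < s ^ 2 := by nlinarith
  set μ := s ^ 2 with hμdef
  have hs0 : 0 < s := by linarith
  have hδ0 : 0 < 1 / (μ - 1) := one_div_pos.mpr (by linarith)
  have hδ : 1 / (μ - 1) ≤ 1 / s := one_div_le_one_div_of_le hs0 (by nlinarith)
  have hδlog : 1 / (μ - 1) * Real.log μ ≤ 2 / s := by
    have h1 : Real.log μ ≤ 2 * (s - 1) := by
      rw [hμdef, Real.log_pow]
      push_cast
      linarith [Real.log_le_sub_one_of_pos hs0]
    rw [one_div_mul_eq_div, div_le_div_iff₀ (by linarith) hs0]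
    nlinarith
  have hδ2 : (1 + 1 / (μ - 1)) * (1 / (μ - 1)) ≤ 2 / s := by
    have h1 : 1 / s ≤ 1 := by rw [div_le_one hs0]; linarith
    have h2 : 2 / s = 2 * (1 / s) := by ring
    rw [h2]
    exact mul_le_mul (by linarith) hδ hδ0.le (by norm_num)
  set δ := 1 / (μ - 1) with hδdef
  have hr1 : 1 < μ / (1 - q) := by rw [lt_div_iff₀ hp]; linarith
  set r := μ / (1 - q) with hr
  have hΦ : 0 < alphaIntegrand α r 1 := by
    refine lt_of_lt_of_le ?_
      (sq_sqrt_sub_sqrt_le_alphaIntegrand hα0 hα2 (by linarith : 0 < r) one_pos)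
    have : √1 < √r := Real.sqrt_lt_sqrt zero_le_one hr1
    exact pow_pos (sub_pos.mpr this) 2
  set Φ := alphaIntegrand α r 1 with hΦdef
  refine ⟨ℓ / 2 / (Φ * (1 + δ)), by positivity, fun a b hab C hC => ?_⟩
  have hn : (1 : ℝ) ≤ ((Finset.Icc a b).card : ℝ) := by
    exact_mod_cast Finset.card_pos.mpr (Finset.nonempty_Icc.mpr hab)
  have h1 := entropy_testFunction_ge (a := a) (b := b) hq0 hq1 hμ
  have h2 := hC.2 (testFunction r) fun σ => pow_pos (by linarith : 0 < r) _
  have h3 := alphaEnergy_testFunction_le (a := a) (b := b) hq0 hq1 hα0 hα2 hr1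
  have h4 : mean q (testFunction (a := a) (b := b) r) ≤
      μ ^ (Finset.Icc a b).card * (1 + δ) := by
    have h1 := mean_testFunction_le (a := a) (b := b) hq0 hq1 (r := r) (by linarith)
    rw [hr, mul_div_cancel₀ _ hp.ne'] at h1
    exact h1.trans (geom_sum_le hμ _)
  set n := (Finset.Icc a b).card
  have hμn : 0 < μ ^ n := by positivity
  have h5 : μ ^ n * (ℓ / 2 * n) ≤ μ ^ n * (C * (Φ * (1 + δ))) := by
    calc μ ^ n * (ℓ / 2 * n) ≤ μ ^ n * (n * ℓ - δ * (n * Real.log μ) - (1 + δ) * δ) := by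
          refine mul_le_mul_of_nonneg_left ?_ hμn.le
          have h6 : 4 / s = 2 / s + 2 / s := by ring
          have h7 : 0 < 2 / s := by positivity
          nlinarith
      _ ≤ C * (Φ * (μ ^ n * (1 + δ))) := (h1.trans h2).trans
          (mul_le_mul_of_nonneg_left (h3.trans (mul_le_mul_of_nonneg_left h4 hΦ.le)) hC.1.le)
      _ = _ := by ring
  rw [div_mul_eq_mul_div, div_le_iff₀ (by positivity)]
  exact le_of_mul_le_mul_left h5 hμn

/-! ### The best constants -/

lemma alphaEnergy_nonneg {q α : ℝ} (hq0 : 0 ≤ q) (hq1 : q ≤ 1) (hα0 : 0 < α) (hα2 : α ≤ 2)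
    {f : Config a b → ℝ} (hf : ∀ σ, 0 < f σ) : 0 ≤ alphaEnergy q α f := by
  refine le_trans ?_ (dirichlet_sqrt_le_alphaEnergy hq0 hq1 hα0 hα2 hf)
  refine mul_nonneg (by norm_num) (Finset.sum_nonneg fun x _ => Finset.sum_nonneg fun σ _ => ?_)
  rw [mul_assoc _ (_ - _) (_ - _)]
  exact mul_nonneg (mul_nonneg (mul_nonneg (weight_nonneg hq0 hq1 σ) (constraint_nonneg σ x))
    (flipRate_ge (m := 0) hq0 (by linarith) σ x)) (mul_self_nonneg _)

/-- The infimum of the admissible constants is admissible as soon as it is positive. -/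
lemma isLeast_bestConstant {q α : ℝ} (hq0 : 0 ≤ q) (hq1 : q ≤ 1) (hα0 : 0 < α) (hα2 : α ≤ 2)
    (hne : (alphaLogSobolevConstants q α a b).Nonempty) (hpos : 0 < bestConstant q α a b) :
    IsLeast (alphaLogSobolevConstants q α a b) (bestConstant q α a b) := by
  have hbdd : BddBelow (alphaLogSobolevConstants q α a b) := ⟨0, fun C hC => hC.1.le⟩
  refine ⟨⟨hpos, fun f hf => ?_⟩, fun C hC => csInf_le hbdd hC⟩
  rcases (alphaEnergy_nonneg hq0 hq1 hα0 hα2 hf).eq_or_lt with h | h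
  · obtain ⟨C, hC⟩ := hne
    have := hC.2 f hf
    rwa [← h, mul_zero] at this ⊢
  · rw [← div_le_iff₀ h]
    exact le_csInf hne fun C hC => (div_le_iff₀ h).mpr (hC.2 f hf)

end EastModel

end

theorem mainTheorem1 (q : ℝ) (hq0 : 0 < q) (hq1 : q < 1) :
    (∀ α : ℝ, 0 < α → α ≤ 2 →
      (∃ c : ℝ, 0 < c ∧ ∀ a b : ℤ, a ≤ b →
        IsLeast (EastModel.alphaLogSobolevConstants q α a b) (EastModel.bestConstant q α a b) ∧
        (1 / c) * ((Finset.Icc a b).card : ℝ) ≤ EastModel.bestConstant q α a b ∧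
        EastModel.bestConstant q α a b ≤ c * ((Finset.Icc a b).card : ℝ)) ∧
      ¬ ∃ C : ℝ, ∀ a b : ℤ, a ≤ b → C ∈ EastModel.alphaLogSobolevConstants q α a b) ∧
    ∃ C : ℝ, 0 < C ∧ ∀ a b : ℤ, a ≤ b → ∀ f : EastModel.Config a b → ℝ,
      EastModel.variance q f ≤ C * EastModel.dirichlet q f f := by
  refine ⟨fun α hα0 hα2 => ?_, EastModel.exists_variance_le hq0 hq1⟩
  obtain ⟨K, hK, hupper⟩ := EastModel.exists_entropy_le hq0 hq1
  obtain ⟨κ, hκ, hlower⟩ := EastModel.exists_mul_card_le hq0 hq1 hα0 hα2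
  constructor
  · refine ⟨max K (1 / κ), lt_max_of_lt_left hK, fun a b hab => ?_⟩
    have hn : (1 : ℝ) ≤ ((Finset.Icc a b).card : ℝ) := by
      exact_mod_cast Finset.card_pos.mpr (Finset.nonempty_Icc.mpr hab)
    have hmem := hupper α hα0 hα2 a b hab
    have hlow : κ * ((Finset.Icc a b).card : ℝ) ≤ EastModel.bestConstant q α a b :=
      le_csInf ⟨_, hmem⟩ (hlower a b hab)
    have hleast := EastModel.isLeast_bestConstant hq0.le hq1.le hα0 hα2 ⟨_, hmem⟩
      (lt_of_lt_of_le (by positivity) hlow)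
    refine ⟨hleast, le_trans ?_ hlow, (hleast.2 hmem).trans ?_⟩
    · refine mul_le_mul_of_nonneg_right ?_ (by linarith)
      rw [one_div_le (lt_max_of_lt_left hK) hκ]
      exact le_max_right _ _
    · exact mul_le_mul_of_nonneg_right (le_max_left _ _) (by linarith)
  · rintro ⟨C, hC⟩
    obtain ⟨n, hn⟩ := exists_nat_gt (C / κ)
    have h := hlower 0 n (by omega) C (hC 0 n (by omega))
    rw [div_lt_iff₀ hκ] at hn
    rw [Int.card_Icc, show ((n : ℤ) + 1 - 0).toNat = n + 1 by omega] at h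
    push_cast at h
    nlinarith
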